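/- **Setting.** Let $(V,E)$ be a connected, locally finite, simple, undirected graph. Let $w:E\to(0,\infty)$, $w_{xy}=w_{yx}$, be an edge weight, extended by $w_{xy}=0$ for $x\not\sim y$, and let $m:V\to(0,\infty)$ be a vertex weight. Then $G=(V,E,m,w)$ is called a weighted graph, with Laplacian $\Delta f(x)=\sum_{y}\frac{w_{xy}}{m_x}(f(y)-f(x))$ and bottom of the spectrum $$\mu_1(G)=\inf\left\{\frac{\frac12\sum_{x,y\in V}w_{xy}|f(x)-f(y)|^2}{\sum_{x\in V}f(x)^2m_x}\;:\;f:V\to\mathbb R \text{ of finite support},\ f\neq0\right\}.$$ Let $d$ be the combinatorial distance. An *admissible metric* is a map $\rho:V\times V\to[0,\infty)$ that is symmetric, vanishes on the diagonal and satisfies the triangle inequality, is intrinsic, i.e. $\sum_y w_{xy}\rho(x,y)^2\le m_x$ for all $x$, has finite balls $\{y:\rho(y,x)\le R\}$ for all $x\in V$, $R>0$, and has finite jump size $s=\sup_{x\sim y}\rho(x,y)<\infty$. For $x_0\in V$ put $A_{R_1}^{R_2}=\{x\in V:R_1\le\rho(x,x_0)\le R_2\}$. For $\mu<t$ (and $t<1$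 if $\rho=d$) let $$a_\mu(t)=\begin{cases}\frac1s\log\bigl(1+s\sqrt{2(t-\mu)}\bigr),&\rho\ne d,\\[1ex] \log\frac{1-\mu}{1-t}+\log\Bigl(1+\sqrt{1-\bigl(\tfrac{1-t}{1-\mu}\bigr)^2}\Bigr),&\rho=d.\end{cases}$$ For finite $\Omega\subset V$ let $p_{t,\Omega}(x,y)$ be the heat kernel of the Laplacian on $\Omega$ with Dirichlet boundary condition, taken with respect to $m$ (and equal to zero unless $x,y\in\Omega$). Let $p_t(x,y)=\sup_{\Omega}p_{t,\Omega}(x,y)$ be the minimal heat kernel and, for $\alpha\ge0$, let $g_\alpha(x,y)=\int_0^\infty e^{-\alpha t}p_t(x,y)\,dt\in[0,\infty]$ be the $\alpha$-resolvent kernel (the minimal Green's function if $\alpha=0$). **Theorem.** (1) Let $G=(V,E,m,w)$ be an infinite weighted graph with $\mu_1(G)>0$, let $\rho$ be an admissible metric, $x_0\in V$, $\alpha\ge0$, and $a=a_{-\alpha}(\mu_1(G))$. Then there is a constant $C$ independent of $R$ with $$\sum_{x\in A_R^{R+3s}}g_\alpha(x_0,x)^2\,m_x\le C e^{-2aR}\qquad\text{for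 all }R>0.$$ (2) The estimate is sharp on homogeneous trees: let $N\ge3$, let $T_N$ be the $N$-regular tree with $w_{xy}=1$ on edges and $m_x=N$, let $\rho=d$, and let $x_0$ be any vertex. Then $T_N$ is infinite, $d$ is an admissible metric with $s=1$, and $\mu_1(T_N)=1-\frac{2\sqrt{N-1}}{N}>0$. For every $\alpha\ge0$, with $b=\frac12\bigl((\alpha+1)N+\sqrt{(\alpha+1)^2N^2-4N+4}\bigr)$, $$g_\alpha(x_0,x)=\frac{1}{N(\alpha+1-\frac1b)}\,b^{-d(x,x_0)}\quad\text{for all vertices }x,$$ and there is a constant $C(N,\alpha)>0$, depending only on $N$ and $\alpha$, with $$\sum_{x\in A_n^{n+3}}g_\alpha(x_0,x)^2\,m_x\sim C(N,\alpha)\Bigl(\frac{N-1}{b^2}\Bigr)^n\quad(n\to\infty),$$ where $\bigl(\frac{N-1}{b^2}\bigr)^n=e^{-2an}$ for all $n\in\mathbb N$, with $a=a_{-\alpha}(\mu_1(T_N))$. -/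

import Mathlib

open scoped ENNReal

/-- A connected, locally finite, simple, undirected graph on `V` with a positive symmetric edge
weight `w` (extended by `0` to non-edges) and a positive vertex weight `m`. -/
structure WeightedGraph (V : Type*) where
  graph : SimpleGraph V
  locallyFinite : ∀ x, (graph.neighborSet x).Finite
  connected : graph.Connected
  w : V → V → ℝ
  w_symm : ∀ x y, w x y = w y x
  w_pos : ∀ x y, graph.Adj x y → 0 < w x y
  w_eq_zero : ∀ x y, ¬ graph.Adj x y → w x y = 0
  m : V → ℝ
  m_pos : ∀ x, 0 < m x

namespace WeightedGraph

variable {V : Type*} (G : WeightedGraph V)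

/-- The finite set of neighbours of a vertex. -/
noncomputable def nbrs (x : V) : Finset V := (G.locallyFinite x).toFinset

/-- The Laplacian `Δ f (x) = ∑_y (w_xy / m_x) (f y - f x)`; only neighbours contribute. -/
noncomputable def laplacian (f : V → ℝ) (x : V) : ℝ :=
  ∑ y ∈ G.nbrs x, G.w x y / G.m x * (f y - f x)

/-- The Dirichlet energy `(1/2) ∑_{x,y} w_xy |f x - f y|^2`
(a finite sum when `f` has finite support). -/
noncomputable def energy (f : V → ℝ) : ℝ :=
  (1 / 2) * ∑' x, ∑ y ∈ G.nbrs x, G.w x y * |f x - f y| ^ 2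

/-- `∑_x f(x)^2 m_x` (a finite sum when `f` has finite support). -/
noncomputable def normSq (f : V → ℝ) : ℝ := ∑' x, f x ^ 2 * G.m x

/-- The bottom of the Dirichlet spectrum on `Ω`: the infimum of the Rayleigh quotients of the
nonzero functions of finite support contained in `Ω`. -/
noncomputable def bottomSpectrum (Ω : Set V) : ℝ :=
  sInf {q : ℝ | ∃ f : V → ℝ, f.support.Finite ∧ f.support ⊆ Ω ∧ f ≠ 0 ∧
    q = G.energy f / G.normSq f}

/-- The combinatorial distance, as a real number. -/
noncomputable def combDist (x y : V) : ℝ := (G.graph.dist x y : ℝ)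

/-- The jump size `s = sup_{x ∼ y} ρ(x,y)`. -/
noncomputable def jumpSize (ρ : V → V → ℝ) : ℝ :=
  sSup {r : ℝ | ∃ x y, G.graph.Adj x y ∧ r = ρ x y}

/-- `ρ` is an intrinsic (pseudo) metric with finite balls and finite jump size. -/
structure IsAdmissibleMetric (ρ : V → V → ℝ) : Prop where
  nonneg : ∀ x y, 0 ≤ ρ x y
  self : ∀ x, ρ x x = 0
  symm : ∀ x y, ρ x y = ρ y x
  triangle : ∀ x y z, ρ x z ≤ ρ x y + ρ y z
  intrinsic : ∀ x, ∑ y ∈ G.nbrs x, G.w x y * ρ x y ^ 2 ≤ G.m x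
  finite_ball : ∀ (x : V) (R : ℝ), 0 < R → {y | ρ y x ≤ R}.Finite
  bddAbove_jump : BddAbove {r : ℝ | ∃ x y, G.graph.Adj x y ∧ r = ρ x y}

open Classical in
/-- The exponent `a_μ(t)`, for `t > μ` if `ρ` is not the combinatorial distance, and for
`μ < t < 1` if it is. -/
noncomputable def decayExponent (ρ : V → V → ℝ) (μ t : ℝ) : ℝ :=
  if ρ = G.combDist then
    Real.log ((1 - μ) / (1 - t)) + Real.log (1 + Real.sqrt (1 - ((1 - t) / (1 - μ)) ^ 2))
  else
    1 / G.jumpSize ρ * Real.log (1 + G.jumpSize ρ * Real.sqrt (2 * (t - μ)))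

open Classical in
/-- The matrix of the Laplacian with Dirichlet boundary condition on a finite set `Ω`, that is, of
`f ↦ (Δ f)|_Ω` for functions `f` on `Ω` extended by zero: the entry at `(x,y)` is `(Δ 1_y)(x)`. -/
noncomputable def dirichletLaplacian (Ω : Finset V) : Matrix Ω Ω ℝ :=
  Matrix.of fun x y => G.laplacian (Pi.single (y : V) 1) x

open Classical in
/-- The heat kernel `p_{t,Ω}(x,y)` with Dirichlet boundary condition on a finite set `Ω`: the kernel
of `exp (t Δ_Ω)` with respect to the measure `m`, extended by zero. -/
noncomputable def dirichletHeatKernel (Ω : Finset V) (t : ℝ) (x y : V) : ℝ :=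
  if h : x ∈ Ω ∧ y ∈ Ω then
    NormedSpace.exp (t • G.dirichletLaplacian Ω) ⟨x, h.1⟩ ⟨y, h.2⟩ / G.m y
  else 0

/-- The minimal heat kernel `p_t(x,y)`: the supremum (which is the limit along any exhaustion) of
the Dirichlet heat kernels on finite sets. -/
noncomputable def heatKernel (t : ℝ) (x y : V) : ℝ≥0∞ :=
  ⨆ Ω : Finset V, ENNReal.ofReal (G.dirichletHeatKernel Ω t x y)

/-- The `α`-resolvent kernel `g_α(x,y) = ∫_0^∞ e^{-α t} p_t(x,y) dt`, with values in `[0,∞]`;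
for `α = 0` this is the minimal Green function. -/
noncomputable def resolventKernel (α : ℝ) (x y : V) : ℝ≥0∞ :=
  ∫⁻ t in Set.Ioi (0 : ℝ), ENNReal.ofReal (Real.exp (-α * t)) * G.heatKernel t x y

/-- The annulus `{x | R₁ ≤ ρ(x,x₀) ≤ R₂}`. -/
def annulus (ρ : V → V → ℝ) (x₀ : V) (R₁ R₂ : ℝ) : Set V :=
  {x | R₁ ≤ ρ x x₀ ∧ ρ x x₀ ≤ R₂}

/-- `∑_{x ∈ A} g_α(x₀,x)^2 m_x`, with values in `[0,∞]`. -/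
noncomputable def resolventSqSum (α : ℝ) (x₀ : V) (A : Set V) : ℝ≥0∞ :=
  ∑' x : A, G.resolventKernel α x₀ x ^ 2 * ENNReal.ofReal (G.m x)

/-- `G` is the `N`-regular tree with the standard weights `w_xy = 1` on edges and `m_x = N`. -/
structure IsRegularTree (N : ℕ) : Prop where
  isTree : G.graph.IsTree
  regular : ∀ x, (G.nbrs x).card = N
  w_eq_one : ∀ x y, G.graph.Adj x y → G.w x y = 1
  m_eq : ∀ x, G.m x = N

end WeightedGraph

/-- The larger solution `b` of `b + (N-1)/b = (α+1) N`. -/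
noncomputable def treeRoot (N : ℕ) (α : ℝ) : ℝ :=
  1 / 2 * ((α + 1) * N + Real.sqrt ((α + 1) ^ 2 * (N : ℝ) ^ 2 - 4 * N + 4))

/-! Part (1) is an Agmon estimate. Put λ = μ₁ + α > 0. On a finite set Ω, cut the time integral
defining the resolvent at T; the resulting function u = `truncatedResolvent` has finite support and
solves (α − Δ)u = δ/m − (a nonnegative remainder) on Ω, where δ/m is the normalised unit mass at x₀.
Testing the Rayleigh quotient with φu gives (`agmon_inequality`) λ ∑ φ²u²m ≤ φ(x₀)²u(x₀) + ½ ∑∑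
w(x,y) u(x) u(y) (φ(x) − φ(y))². Take φ = exp(a·min(ρ(·,x₀), R − s)). It is constant across every
edge with an endpoint outside B = {ρ(·,x₀) < R}. The exponent a is exactly the one for which the
gradient term over B is at most λ ∑_B φ²u²m, so it is absorbed by the left side and only the part
outside B survives (`weighted_sum_le`). As u(x₀) ≤ 1/(λ m(x₀)), the bound is uniform in Ω and T and
passes to the limit. The absorption has two forms. For a general metric it follows from the
intrinsic condition and convexity of exp. For the combinatorial distance it uses (1 − μ₁) cosh a = 1
+ α and the bound 1 − μ₁ for the adjacency form.

Part (2) is explicit computation. The radial function θ^{-|x|}, θ = √(N−1), is a positive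
supersolution, which bounds μ₁ from below; its truncations bound μ₁ from above. The radial function
c·b^{-|x|} solves the resolvent equation, and comparison on balls identifies it with the minimal
kernel (`resolventKernel_eq`). Sphere sizes N(N−1)^{k−1} then give the annulus sums, and e^a = b/θ
matches the rates. -/

namespace WeightedGraph

/-! ### The Laplacian as a finite sum and its Dirichlet matrix -/

variable {V : Type*} (G : WeightedGraph V)

/-- The weighted degree `∑_y w_xy`. -/
noncomputable def deg (x : V) : ℝ := ∑ y ∈ G.nbrs x, G.w x y

theorem mem_nbrs {x y : V} : y ∈ G.nbrs x ↔ G.graph.Adj x y := by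
  simp [nbrs]

theorem w_nonneg (x y : V) : 0 ≤ G.w x y := by
  by_cases h : G.graph.Adj x y
  · exact (G.w_pos x y h).le
  · exact (G.w_eq_zero x y h).ge

theorem deg_nonneg (x : V) : 0 ≤ G.deg x := Finset.sum_nonneg fun y _ => G.w_nonneg x y

/-- Both sums only see edges from x into S. This trades neighbourhoods that vary with x for one
fixed index set, so that double sums can be interchanged. -/
theorem sum_nbrs_eq (x : V) {S : Finset V} {f : V → ℝ} (hf : ∀ y ∉ S, f y = 0) :
    ∑ y ∈ G.nbrs x, G.w x y * f y = ∑ y ∈ S, G.w x y * f y := by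
  classical
  have h1 : ∑ y ∈ G.nbrs x, G.w x y * f y = ∑ y ∈ G.nbrs x ∪ S, G.w x y * f y := by
    refine Finset.sum_subset Finset.subset_union_left fun y _ hy => ?_
    rw [G.w_eq_zero x y (by rwa [mem_nbrs] at hy), zero_mul]
  have h2 : ∑ y ∈ S, G.w x y * f y = ∑ y ∈ G.nbrs x ∪ S, G.w x y * f y := by
    refine Finset.sum_subset Finset.subset_union_right fun y _ hy => ?_
    rw [hf y hy, mul_zero]
  rw [h1, h2]

theorem mul_laplacian (f : V → ℝ) (x : V) :
    G.m x * G.laplacian f x = ∑ y ∈ G.nbrs x, G.w x y * f y - G.deg x * f x := by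
  have := (G.m_pos x).ne'
  rw [laplacian, deg, Finset.sum_mul, ← Finset.sum_sub_distrib, Finset.mul_sum]
  refine Finset.sum_congr rfl fun y _ => ?_
  field_simp

theorem mul_laplacian_of_support (x : V) {S : Finset V} {f : V → ℝ} (hf : ∀ y ∉ S, f y = 0) :
    G.m x * G.laplacian f x = ∑ y ∈ S, G.w x y * f y - G.deg x * f x := by
  rw [mul_laplacian, G.sum_nbrs_eq x hf]

open Classical in
theorem dirichletLaplacian_apply (Ω : Finset V) (x y : Ω) :
    G.dirichletLaplacian Ω x y = G.w x y / G.m x - if x = y then G.deg x / G.m x else 0 := by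
  have hm := (G.m_pos x).ne'
  have h := G.mul_laplacian_of_support (x : V) (S := {(y : V)}) (f := Pi.single (y : V) 1)
    (by intro z hz; simp at hz; simp [hz])
  rw [dirichletLaplacian, Matrix.of_apply, eq_comm, ← mul_right_inj' hm, h]
  by_cases hxy : x = y
  · subst hxy; simp; field_simp
  · have : (x : V) ≠ y := fun h => hxy (Subtype.ext h)
    simp [hxy, this]; field_simp

/-! ### Exponentials of matrices with nonnegative off-diagonal entries -/

section Matrix

open Matrix

theorem pow_apply_nonneg {n : Type*} [Fintype n] [DecidableEq n] {A : Matrix n n ℝ}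
    (h : ∀ i j, 0 ≤ A i j) (k : ℕ) (i j : n) : 0 ≤ (A ^ k) i j := by
  induction k generalizing i j with
  | zero => rw [pow_zero, Matrix.one_apply]; split_ifs <;> norm_num
  | succ k ih =>
    rw [pow_succ, Matrix.mul_apply]
    exact Finset.sum_nonneg fun l _ => mul_nonneg (ih i l) (h l j)

/-- An entry of a k-th power is a sum of weights of paths of length k; `e` maps paths injectively to
paths of at least the same weight. -/
theorem pow_apply_le_pow_apply {n n' : Type*} [Fintype n] [DecidableEq n] [Fintype n']
    [DecidableEq n'] {A : Matrix n n ℝ} {B : Matrix n' n' ℝ} (e : n ↪ n')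
    (hA : ∀ i j, 0 ≤ A i j) (hB : ∀ i j, 0 ≤ B i j) (h : ∀ i j, A i j ≤ B (e i) (e j))
    (k : ℕ) (i j : n) : (A ^ k) i j ≤ (B ^ k) (e i) (e j) := by
  induction k generalizing i j with
  | zero =>
    rw [pow_zero, pow_zero, Matrix.one_apply, Matrix.one_apply]
    simp
  | succ k ih =>
    rw [pow_succ, pow_succ, Matrix.mul_apply, Matrix.mul_apply]
    calc ∑ l, (A ^ k) i l * A l j ≤ ∑ l, (B ^ k) (e i) (e l) * B (e l) (e j) :=
          Finset.sum_le_sum fun l _ => mul_le_mul (ih i l) (h l j) (hA l j)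
            (pow_apply_nonneg hB k _ _)
      _ = ∑ l ∈ Finset.univ.map e, (B ^ k) (e i) l * B l (e j) := by rw [Finset.sum_map]
      _ ≤ _ := Finset.sum_le_sum_of_subset_of_nonneg (Finset.subset_univ _) fun l _ _ =>
          mul_nonneg (pow_apply_nonneg hB k _ _) (hB _ _)

open scoped Matrix.Norms.Operator in
theorem hasSum_exp_apply {n : Type*} [Fintype n] [DecidableEq n] (A : Matrix n n ℝ) (i j : n) :
    HasSum (fun k : ℕ => (k.factorial : ℝ)⁻¹ * (A ^ k) i j) (NormedSpace.exp A i j) := by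
  have h := NormedSpace.exp_series_hasSum_exp' (𝕂 := ℝ) A
  exact Pi.hasSum.1 (Pi.hasSum.1 h i) j

/-- The scalar matrix commutes with everything. For c large a Dirichlet Laplacian becomes entrywise
nonnegative, so its exponential series can be compared term by term. -/
theorem exp_smul_eq_shift {n : Type*} [Fintype n] [DecidableEq n] (A : Matrix n n ℝ) (t c : ℝ) :
    NormedSpace.exp (t • A) = Real.exp (-(t * c)) • NormedSpace.exp (t • (A + c • 1)) := by
  have h1 : t • A = (-(t * c)) • (1 : Matrix n n ℝ) + t • (A + c • 1) := by
    rw [smul_add, smul_smul, neg_smul]; abel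
  rw [h1, Matrix.exp_add_of_commute _ _ ((Commute.one_left _).smul_left _)]
  have h2 : NormedSpace.exp ((-(t * c)) • (1 : Matrix n n ℝ)) = Real.exp (-(t * c)) • 1 := by
    rw [Matrix.smul_one_eq_diagonal, Matrix.smul_one_eq_diagonal, Matrix.exp_diagonal,
      Real.exp_eq_exp_ℝ]
    congr 1
    ext i
    rw [Pi.coe_exp]
  rw [h2, smul_mul_assoc, one_mul]

theorem exp_smul_apply_nonneg {n : Type*} [Fintype n] [DecidableEq n] {A : Matrix n n ℝ} {c : ℝ}
    (h : ∀ i j, 0 ≤ (A + c • 1) i j) {t : ℝ} (ht : 0 ≤ t) (i j : n) :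
    0 ≤ NormedSpace.exp (t • A) i j := by
  rw [exp_smul_eq_shift A t c, Matrix.smul_apply, smul_eq_mul]
  refine mul_nonneg (Real.exp_pos _).le ((hasSum_exp_apply _ i j).nonneg fun k => ?_)
  exact mul_nonneg (by positivity) (pow_apply_nonneg (fun i j => mul_nonneg ht (h i j)) k i j)

theorem exp_smul_apply_le {n n' : Type*} [Fintype n] [DecidableEq n] [Fintype n']
    [DecidableEq n'] {A : Matrix n n ℝ} {B : Matrix n' n' ℝ} {c : ℝ} (e : n ↪ n')
    (hA : ∀ i j, 0 ≤ (A + c • 1) i j) (hB : ∀ i j, 0 ≤ (B + c • 1) i j)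
    (h : ∀ i j, A i j ≤ B (e i) (e j)) {t : ℝ} (ht : 0 ≤ t) (i j : n) :
    NormedSpace.exp (t • A) i j ≤ NormedSpace.exp (t • B) (e i) (e j) := by
  rw [exp_smul_eq_shift A t c, exp_smul_eq_shift B t c, Matrix.smul_apply, Matrix.smul_apply]
  refine mul_le_mul_of_nonneg_left ?_ (Real.exp_pos _).le
  refine hasSum_le (fun k => ?_) (hasSum_exp_apply _ i j) (hasSum_exp_apply _ (e i) (e j))
  refine mul_le_mul_of_nonneg_left ?_ (by positivity)
  refine pow_apply_le_pow_apply e (fun i j => mul_nonneg ht (hA i j))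
    (fun i j => mul_nonneg ht (hB i j)) (fun i j => mul_le_mul_of_nonneg_left ?_ ht) k i j
  simpa [Matrix.one_apply] using h i j

open scoped Matrix.Norms.Operator in
theorem hasDerivAt_exp_smul_apply {n : Type*} [Fintype n] [DecidableEq n] (A : Matrix n n ℝ)
    (t : ℝ) (i j : n) :
    HasDerivAt (fun t : ℝ => NormedSpace.exp (t • A) i j)
      (∑ k, NormedSpace.exp (t • A) i k * A k j) t := by
  have h := hasDerivAt_exp_smul_const (𝕂 := ℝ) A t
  have := hasDerivAt_pi.1 (hasDerivAt_pi.1 h i) j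
  rwa [Matrix.mul_apply] at this

end Matrix

/-! ### Dirichlet heat kernels: positivity, domain monotonicity, heat equation -/

section HeatKernel

variable (Ω : Finset V)

theorem dirichletHeatKernel_of_notMem_left {x : V} (hx : x ∉ Ω) (t : ℝ) (y : V) :
    G.dirichletHeatKernel Ω t x y = 0 := by
  simp [dirichletHeatKernel, hx]

theorem dirichletHeatKernel_of_notMem_right {y : V} (hy : y ∉ Ω) (t : ℝ) (x : V) :
    G.dirichletHeatKernel Ω t x y = 0 := by
  simp [dirichletHeatKernel, hy]

open Classical in
theorem dirichletLaplacian_add_nonneg {c : ℝ} (hc : ∀ x ∈ Ω, G.deg x / G.m x ≤ c) (x y : Ω) :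
    0 ≤ (G.dirichletLaplacian Ω + c • 1) x y := by
  rw [Matrix.add_apply, Matrix.smul_apply, dirichletLaplacian_apply, Matrix.one_apply]
  have h1 : 0 ≤ G.w x y / G.m x := div_nonneg (G.w_nonneg _ _) (G.m_pos _).le
  have h2 := hc x x.2
  split_ifs
  · simp; linarith
  · simpa using h1

theorem exists_deg_div_le : ∃ c : ℝ, ∀ x ∈ Ω, G.deg x / G.m x ≤ c := by
  refine ⟨∑ x ∈ Ω, G.deg x / G.m x, fun x hx => ?_⟩
  exact Finset.single_le_sum (f := fun x => G.deg x / G.m x)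
    (fun x _ => div_nonneg (G.deg_nonneg x) (G.m_pos x).le) hx

theorem dirichletHeatKernel_nonneg {t : ℝ} (ht : 0 ≤ t) (x y : V) :
    0 ≤ G.dirichletHeatKernel Ω t x y := by
  classical
  obtain ⟨c, hc⟩ := G.exists_deg_div_le Ω
  rw [dirichletHeatKernel]
  split_ifs with h
  · refine div_nonneg ?_ (G.m_pos y).le
    convert exp_smul_apply_nonneg (G.dirichletLaplacian_add_nonneg Ω hc) ht ⟨x, h.1⟩ ⟨y, h.2⟩
  · exact le_rfl

/-- The Dirichlet matrix of Ω is a principal submatrix of that of Ω', and one shift c serves both.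
-/
theorem dirichletHeatKernel_mono {Ω Ω' : Finset V} (hΩ : Ω ⊆ Ω') {t : ℝ} (ht : 0 ≤ t) (x y : V) :
    G.dirichletHeatKernel Ω t x y ≤ G.dirichletHeatKernel Ω' t x y := by
  classical
  by_cases h : x ∈ Ω ∧ y ∈ Ω
  · have h' : x ∈ Ω' ∧ y ∈ Ω' := ⟨hΩ h.1, hΩ h.2⟩
    obtain ⟨c, hc⟩ := G.exists_deg_div_le Ω'
    rw [dirichletHeatKernel, dirichletHeatKernel, dif_pos h, dif_pos h']
    refine div_le_div_of_nonneg_right ?_ (G.m_pos y).le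
    let e : Ω ↪ Ω' := ⟨fun x => ⟨x, hΩ x.2⟩, fun x y hxy => by
      exact Subtype.ext (Subtype.mk.inj hxy)⟩
    have := exp_smul_apply_le e
      (G.dirichletLaplacian_add_nonneg Ω fun x hx => hc x (hΩ hx))
      (G.dirichletLaplacian_add_nonneg Ω' hc) (fun i j => ?_) ht ⟨x, h.1⟩ ⟨y, h.2⟩
    · exact this
    · rw [dirichletLaplacian_apply, dirichletLaplacian_apply]
      have hij : i = j ↔ e i = e j := e.injective.eq_iff.symm
      have hi : ((e i : Ω') : V) = i := rfl
      have hj : ((e j : Ω') : V) = j := rfl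
      simp only [hij, hi, hj, le_refl]
  · rw [dirichletHeatKernel, dif_neg h]
    exact G.dirichletHeatKernel_nonneg Ω' ht x y

/-- Differentiation puts the matrix on the right of the exponential, acting on the second index.
Symmetry of w and the division by m turn this column action into the Laplacian in y. -/
theorem hasDerivAt_dirichletHeatKernel (t : ℝ) (x : V) {y : V} (hy : y ∈ Ω) :
    HasDerivAt (fun t => G.dirichletHeatKernel Ω t x y)
      (G.laplacian (fun z => G.dirichletHeatKernel Ω t x z) y) t := by
  classical
  by_cases hx : x ∈ Ω
  · have hm := (G.m_pos y).ne'
    have hval : ∀ t z (hz : z ∈ Ω), G.dirichletHeatKernel Ω t x z =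
        NormedSpace.exp (t • G.dirichletLaplacian Ω) ⟨x, hx⟩ ⟨z, hz⟩ / G.m z := by
      intro t z hz
      rw [dirichletHeatKernel, dif_pos ⟨hx, hz⟩]
    have h := (hasDerivAt_exp_smul_apply (G.dirichletLaplacian Ω) t ⟨x, hx⟩ ⟨y, hy⟩).div_const
      (G.m y)
    have h2 : (fun t => G.dirichletHeatKernel Ω t x y) = fun t =>
        NormedSpace.exp (t • G.dirichletLaplacian Ω) ⟨x, hx⟩ ⟨y, hy⟩ / G.m y := by
      ext t; exact hval t y hy
    rw [h2]
    refine h.congr_deriv ?_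
    symm
    have hs := G.mul_laplacian_of_support y (S := Ω)
      (f := fun z => G.dirichletHeatKernel Ω t x z)
      fun z hz => G.dirichletHeatKernel_of_notMem_right Ω hz t x
    rw [eq_div_iff hm, mul_comm, hs, ← Finset.sum_coe_sort]
    have : ∀ k : Ω, NormedSpace.exp (t • G.dirichletLaplacian Ω) ⟨x, hx⟩ k *
        G.dirichletLaplacian Ω k ⟨y, hy⟩ = G.w y k * G.dirichletHeatKernel Ω t x k -
        if k = ⟨y, hy⟩ then G.deg y * G.dirichletHeatKernel Ω t x y else 0 := by
      intro k
      have hk := (G.m_pos k).ne'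
      rw [dirichletLaplacian_apply, hval t k k.2, hval t y hy, G.w_symm y k]
      split_ifs with h
      · subst h; field_simp
      · field_simp; ring
    rw [Finset.sum_congr rfl fun k _ => this k, Finset.sum_sub_distrib]
    simp
  · simp only [G.dirichletHeatKernel_of_notMem_left Ω hx]
    have : G.laplacian (fun _ => 0) y = 0 := by simp [laplacian]
    rw [this]
    exact hasDerivAt_const _ _

theorem continuous_dirichletHeatKernel (x y : V) :
    Continuous fun t => G.dirichletHeatKernel Ω t x y := by
  by_cases hy : y ∈ Ω
  · exact continuous_iff_continuousAt.2 fun t =>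
      (G.hasDerivAt_dirichletHeatKernel Ω t x hy).continuousAt
  · simpa only [G.dirichletHeatKernel_of_notMem_right Ω hy] using continuous_const

open Classical in
theorem dirichletHeatKernel_zero {x : V} (hx : x ∈ Ω) (y : V) :
    G.dirichletHeatKernel Ω 0 x y = if x = y then 1 / G.m y else 0 := by
  by_cases hy : y ∈ Ω
  · rw [dirichletHeatKernel, dif_pos ⟨hx, hy⟩, zero_smul, NormedSpace.exp_zero, Matrix.one_apply]
    simp only [Subtype.mk.injEq]
    split_ifs <;> simp
  · rw [G.dirichletHeatKernel_of_notMem_right Ω hy, if_neg]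
    rintro rfl; exact hy hx

end HeatKernel

/-! ### Truncated resolvents, the Dirichlet semigroup and comparison -/

section Resolvent

open MeasureTheory Filter Topology

/-- The resolvent kernel on a finite set, with the time integral cut off at `T`. -/
noncomputable def truncatedResolvent (Ω : Finset V) (α T : ℝ) (x y : V) : ℝ :=
  ∫ t in (0 : ℝ)..T, Real.exp (-α * t) * G.dirichletHeatKernel Ω t x y

theorem continuous_exp_mul_dirichletHeatKernel (Ω : Finset V) (α : ℝ) (x y : V) :
    Continuous fun t : ℝ => Real.exp (-α * t) * G.dirichletHeatKernel Ω t x y :=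
  (by fun_prop : Continuous fun t : ℝ => Real.exp (-α * t)).mul
    (G.continuous_dirichletHeatKernel Ω x y)

theorem truncatedResolvent_nonneg (Ω : Finset V) (α : ℝ) {T : ℝ} (hT : 0 ≤ T) (x y : V) :
    0 ≤ G.truncatedResolvent Ω α T x y :=
  intervalIntegral.integral_nonneg hT fun _ ht =>
    mul_nonneg (Real.exp_pos _).le (G.dirichletHeatKernel_nonneg Ω ht.1 x y)

theorem truncatedResolvent_of_notMem_right {Ω : Finset V} {y : V} (hy : y ∉ Ω) (α T : ℝ) (x : V) :
    G.truncatedResolvent Ω α T x y = 0 := by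
  simp [truncatedResolvent, G.dirichletHeatKernel_of_notMem_right Ω hy]

theorem ofReal_truncatedResolvent (Ω : Finset V) (α : ℝ) {T : ℝ} (hT : 0 ≤ T) (x y : V) :
    ENNReal.ofReal (G.truncatedResolvent Ω α T x y) =
      ∫⁻ t in Set.Ioc 0 T, ENNReal.ofReal (Real.exp (-α * t)) *
        ENNReal.ofReal (G.dirichletHeatKernel Ω t x y) := by
  rw [truncatedResolvent, intervalIntegral.integral_of_le hT, ofReal_integral_eq_lintegral_ofReal]
  · refine lintegral_congr fun t => ?_
    rw [ENNReal.ofReal_mul (Real.exp_pos _).le]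
  · exact ((G.continuous_exp_mul_dirichletHeatKernel Ω α x y).integrableOn_Icc).mono_set
      Set.Ioc_subset_Icc_self
  · filter_upwards [ae_restrict_mem measurableSet_Ioc] with t ht
    exact mul_nonneg (Real.exp_pos _).le (G.dirichletHeatKernel_nonneg Ω ht.1.le x y)

/-- Monotone convergence, with the set and the time horizon growing together. The supremum over all
finite sets is reached along the sequence since each finite set lies in some `Ω n`. -/
theorem tendsto_truncatedResolvent {Ω : ℕ → Finset V} (hmono : Monotone Ω)
    (hex : ∀ x, ∃ n, x ∈ Ω n) (α : ℝ) (x y : V) :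
    Tendsto (fun n : ℕ => ENNReal.ofReal (G.truncatedResolvent (Ω n) α n x y)) atTop
      (𝓝 (G.resolventKernel α x y)) := by
  set f : ℕ → ℝ → ℝ≥0∞ := fun n => (Set.Ioc (0 : ℝ) n).indicator fun t =>
    ENNReal.ofReal (Real.exp (-α * t)) * ENNReal.ofReal (G.dirichletHeatKernel (Ω n) t x y) with hf
  have hmeas : ∀ n, Measurable (f n) := fun n => by
    refine Measurable.indicator ?_ measurableSet_Ioc
    exact (ENNReal.measurable_ofReal.comp (by fun_prop)).mul
      (ENNReal.measurable_ofReal.comp (G.continuous_dirichletHeatKernel (Ω n) x y).measurable)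
  have hfmono : Monotone f := by
    intro n k hnk t
    by_cases ht : t ∈ Set.Ioc (0 : ℝ) n
    · have ht' : t ∈ Set.Ioc (0 : ℝ) k := ⟨ht.1, ht.2.trans (by exact_mod_cast hnk)⟩
      simp only [hf, Set.indicator_of_mem ht, Set.indicator_of_mem ht']
      gcongr
      exact G.dirichletHeatKernel_mono (hmono hnk) ht.1.le x y
    · simp [hf, Set.indicator_of_notMem ht]
  have hsub : ∀ S : Finset V, ∃ n, S ⊆ Ω n := by
    classical
    intro S
    induction S using Finset.induction_on with
    | empty => exact ⟨0, Finset.empty_subset _⟩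
    | insert a S _ ih =>
      obtain ⟨n, hn⟩ := ih
      obtain ⟨k, hk⟩ := hex a
      refine ⟨max n k, Finset.insert_subset (hmono (le_max_right n k) hk)
        (hn.trans (hmono (le_max_left n k)))⟩
  have hsup : ∀ t ∈ Set.Ioi (0 : ℝ), ⨆ n, f n t =
      ENNReal.ofReal (Real.exp (-α * t)) * G.heatKernel t x y := by
    intro t ht
    apply le_antisymm
    · refine iSup_le fun n => ?_
      refine (Set.indicator_le_self' (fun _ _ => zero_le) t).trans ?_
      gcongr
      exact le_iSup (fun S : Finset V => ENNReal.ofReal (G.dirichletHeatKernel S t x y)) (Ω n)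
    · rw [heatKernel, ENNReal.mul_iSup]
      refine iSup_le fun S => ?_
      obtain ⟨n, hn⟩ := hsub S
      obtain ⟨k, hk⟩ := exists_nat_ge t
      refine le_trans ?_ (le_iSup (fun n => f n t) (max n k))
      have hmem : t ∈ Set.Ioc (0 : ℝ) (max n k : ℕ) :=
        ⟨ht, hk.trans (by exact_mod_cast le_max_right n k)⟩
      simp only [hf, Set.indicator_of_mem hmem]
      gcongr
      exact G.dirichletHeatKernel_mono (hn.trans (hmono (le_max_left n k))) (le_of_lt ht) x y
  have hint : ∀ n : ℕ, ∫⁻ t in Set.Ioi (0 : ℝ), f n t =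
      ENNReal.ofReal (G.truncatedResolvent (Ω n) α n x y) := by
    intro n
    rw [G.ofReal_truncatedResolvent _ _ n.cast_nonneg, lintegral_indicator measurableSet_Ioc,
      Measure.restrict_restrict measurableSet_Ioc,
      Set.inter_eq_left.2 (Set.Ioc_subset_Ioi_self)]
  have hlim : G.resolventKernel α x y = ⨆ n, ENNReal.ofReal
      (G.truncatedResolvent (Ω n) α n x y) := by
    rw [resolventKernel, ← setLIntegral_congr_fun measurableSet_Ioi hsup,
      lintegral_iSup hmeas hfmono]
    exact iSup_congr hint
  rw [hlim]
  refine tendsto_atTop_iSup fun n k hnk => ?_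
  rw [← hint n, ← hint k]
  exact lintegral_mono (hfmono hnk)

theorem sum_laplacian_mul_comm {S : Finset V} {f g : V → ℝ} (hf : ∀ y ∉ S, f y = 0)
    (hg : ∀ y ∉ S, g y = 0) :
    ∑ x ∈ S, G.m x * G.laplacian f x * g x = ∑ x ∈ S, f x * (G.m x * G.laplacian g x) := by
  simp only [G.mul_laplacian_of_support _ hf, G.mul_laplacian_of_support _ hg, sub_mul, mul_sub,
    Finset.sum_sub_distrib, Finset.sum_mul, Finset.mul_sum]
  congr 1
  · rw [Finset.sum_comm]
    refine Finset.sum_congr rfl fun x _ => Finset.sum_congr rfl fun y _ => ?_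
    rw [G.w_symm]; ring
  · exact Finset.sum_congr rfl fun x _ => by ring

/-- The Dirichlet heat semigroup on `Ω` applied to `f`, evaluated at `x`. -/
noncomputable def dirichletSemigroup (Ω : Finset V) (t : ℝ) (f : V → ℝ) (x : V) : ℝ :=
  ∑ y ∈ Ω, G.dirichletHeatKernel Ω t x y * (G.m y * f y)

theorem dirichletSemigroup_mono (Ω : Finset V) {t : ℝ} (ht : 0 ≤ t) {f g : V → ℝ}
    (h : ∀ y ∈ Ω, f y ≤ g y) (x : V) :
    G.dirichletSemigroup Ω t f x ≤ G.dirichletSemigroup Ω t g x :=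
  Finset.sum_le_sum fun y hy => mul_le_mul_of_nonneg_left
    (mul_le_mul_of_nonneg_left (h y hy) (G.m_pos y).le) (G.dirichletHeatKernel_nonneg Ω ht x y)

theorem dirichletSemigroup_const_mul (Ω : Finset V) (t c : ℝ) (f : V → ℝ) (x : V) :
    G.dirichletSemigroup Ω t (fun y => c * f y) x = c * G.dirichletSemigroup Ω t f x := by
  rw [dirichletSemigroup, dirichletSemigroup, Finset.mul_sum]
  exact Finset.sum_congr rfl fun y _ => by ring

theorem dirichletSemigroup_zero {Ω : Finset V} {x : V} (hx : x ∈ Ω) (f : V → ℝ) :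
    G.dirichletSemigroup Ω 0 f x = f x := by
  classical
  have hm := (G.m_pos x).ne'
  simp only [dirichletSemigroup, G.dirichletHeatKernel_zero Ω hx, ite_mul, zero_mul,
    Finset.sum_ite_eq, hx, if_true]
  field_simp

theorem dirichletSemigroup_single [DecidableEq V] (Ω : Finset V) (t : ℝ) (x z : V) :
    G.dirichletSemigroup Ω t (fun y => if y = z then 1 / G.m z else 0) x =
      G.dirichletHeatKernel Ω t x z := by
  have hm := (G.m_pos z).ne'
  by_cases hz : z ∈ Ω
  · simp [dirichletSemigroup, hz, hm]
  · simp [dirichletSemigroup, hz, G.dirichletHeatKernel_of_notMem_right Ω hz]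

/-- The heat equation in y is moved onto f by Green's formula, which needs f to vanish off Ω. -/
theorem hasDerivAt_dirichletSemigroup {Ω : Finset V} {f : V → ℝ} (hf : ∀ y ∉ Ω, f y = 0) (t : ℝ)
    (x : V) : HasDerivAt (fun t => G.dirichletSemigroup Ω t f x)
      (G.dirichletSemigroup Ω t (G.laplacian f) x) t := by
  have h : HasDerivAt (fun t => G.dirichletSemigroup Ω t f x)
      (∑ y ∈ Ω, G.laplacian (fun z => G.dirichletHeatKernel Ω t x z) y * (G.m y * f y)) t :=
    HasDerivAt.fun_sum fun y hy => (G.hasDerivAt_dirichletHeatKernel Ω t x hy).mul_const _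
  refine h.congr_deriv ?_
  rw [dirichletSemigroup, ← G.sum_laplacian_mul_comm
    (fun y hy => G.dirichletHeatKernel_of_notMem_right Ω hy t x) hf]
  exact Finset.sum_congr rfl fun y _ => by ring

theorem continuous_dirichletSemigroup (Ω : Finset V) (f : V → ℝ) (x : V) :
    Continuous fun t => G.dirichletSemigroup Ω t f x :=
  continuous_finsetSum _ fun y _ => (G.continuous_dirichletHeatKernel Ω x y).mul continuous_const

theorem continuous_exp_mul_dirichletSemigroup (Ω : Finset V) (α : ℝ) (f : V → ℝ) (x : V) :
    Continuous fun t : ℝ => Real.exp (-α * t) * G.dirichletSemigroup Ω t f x :=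
  (by fun_prop : Continuous fun t : ℝ => Real.exp (-α * t)).mul
    (G.continuous_dirichletSemigroup Ω f x)

/-- Duhamel's formula: integrate the time derivative of the discounted semigroup. With positivity of
the heat kernel it takes the place of a maximum principle in all comparisons below. -/
theorem sub_exp_mul_dirichletSemigroup {Ω : Finset V} {f : V → ℝ} (hf : ∀ y ∉ Ω, f y = 0)
    (α T : ℝ) {x : V} (hx : x ∈ Ω) :
    f x - Real.exp (-α * T) * G.dirichletSemigroup Ω T f x =
      ∫ t in (0 : ℝ)..T, Real.exp (-α * t) *
        G.dirichletSemigroup Ω t (fun y => α * f y - G.laplacian f y) x := by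
  have hlin : ∀ t, G.dirichletSemigroup Ω t (fun y => α * f y - G.laplacian f y) x =
      α * G.dirichletSemigroup Ω t f x - G.dirichletSemigroup Ω t (G.laplacian f) x := by
    intro t
    simp only [dirichletSemigroup]
    rw [Finset.mul_sum, ← Finset.sum_sub_distrib]
    exact Finset.sum_congr rfl fun y _ => by ring
  have hd : ∀ t, HasDerivAt (fun t => -(Real.exp (-α * t) * G.dirichletSemigroup Ω t f x))
      (Real.exp (-α * t) *
        G.dirichletSemigroup Ω t (fun y => α * f y - G.laplacian f y) x) t := by
    intro t
    have h1 : HasDerivAt (fun t : ℝ => Real.exp (-α * t)) (Real.exp (-α * t) * (-α)) t := by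
      simpa using ((hasDerivAt_id t).const_mul (-α)).exp
    refine (h1.mul (G.hasDerivAt_dirichletSemigroup hf t x)).neg.congr_deriv ?_
    rw [hlin]; ring
  rw [intervalIntegral.integral_eq_sub_of_hasDerivAt (fun t _ => hd t)]
  · rw [G.dirichletSemigroup_zero hx]; simp; ring
  · exact (G.continuous_exp_mul_dirichletSemigroup Ω α _ x).intervalIntegrable _ _

theorem sub_exp_mul_dirichletSemigroup_le_truncatedResolvent [DecidableEq V] {Ω : Finset V}
    {f : V → ℝ} (hf : ∀ y ∉ Ω, f y = 0) {α T : ℝ} (hT : 0 ≤ T) {x z : V} (hx : x ∈ Ω)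
    (h : ∀ y ∈ Ω, α * f y - G.laplacian f y ≤ if y = z then 1 / G.m z else 0) :
    f x - Real.exp (-α * T) * G.dirichletSemigroup Ω T f x ≤ G.truncatedResolvent Ω α T x z := by
  rw [G.sub_exp_mul_dirichletSemigroup hf α T hx, truncatedResolvent]
  refine intervalIntegral.integral_mono_on hT
    ((G.continuous_exp_mul_dirichletSemigroup Ω α _ x).intervalIntegrable _ _)
    ((G.continuous_exp_mul_dirichletHeatKernel Ω α x z).intervalIntegrable _ _) fun t ht => ?_
  rw [← G.dirichletSemigroup_single]
  exact mul_le_mul_of_nonneg_left (G.dirichletSemigroup_mono Ω ht.1 h x) (Real.exp_pos _).le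

theorem dirichletSemigroup_nonneg {Ω : Finset V} {t : ℝ} (ht : 0 ≤ t) {f : V → ℝ}
    (hf : ∀ y ∈ Ω, 0 ≤ f y) (x : V) : 0 ≤ G.dirichletSemigroup Ω t f x :=
  Finset.sum_nonneg fun y hy => mul_nonneg (G.dirichletHeatKernel_nonneg Ω ht x y)
    (mul_nonneg (G.m_pos y).le (hf y hy))

theorem truncatedResolvent_le_of_supersolution [DecidableEq V] {Ω : Finset V}
    {f : V → ℝ} (hf : ∀ y ∉ Ω, f y = 0) (hpos : ∀ y ∈ Ω, 0 ≤ f y) {α T : ℝ} (hT : 0 ≤ T)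
    {x z : V} (hx : x ∈ Ω)
    (h : ∀ y ∈ Ω, (if y = z then 1 / G.m z else 0) ≤ α * f y - G.laplacian f y) :
    G.truncatedResolvent Ω α T x z ≤ f x := by
  have h1 := mul_nonneg (Real.exp_pos (-α * T)).le (G.dirichletSemigroup_nonneg hT hpos x)
  have h2 : G.truncatedResolvent Ω α T x z ≤
      f x - Real.exp (-α * T) * G.dirichletSemigroup Ω T f x := by
    rw [G.sub_exp_mul_dirichletSemigroup hf α T hx, truncatedResolvent]
    refine intervalIntegral.integral_mono_on hT
      ((G.continuous_exp_mul_dirichletHeatKernel Ω α x z).intervalIntegrable _ _)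
      ((G.continuous_exp_mul_dirichletSemigroup Ω α _ x).intervalIntegrable _ _) fun t ht => ?_
    rw [← G.dirichletSemigroup_single]
    exact mul_le_mul_of_nonneg_left (G.dirichletSemigroup_mono Ω ht.1 h x) (Real.exp_pos _).le
  linarith

/-- A function with `Δ f ≤ -l f` decays exponentially under the semigroup. -/
theorem exp_mul_dirichletSemigroup_le {Ω : Finset V}
    {f : V → ℝ} (hf : ∀ y ∉ Ω, f y = 0) {l T : ℝ} (hT : 0 ≤ T) {x : V} (hx : x ∈ Ω)
    (h : ∀ y ∈ Ω, G.laplacian f y ≤ -l * f y) :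
    Real.exp (l * T) * G.dirichletSemigroup Ω T f x ≤ f x := by
  have h1 := G.sub_exp_mul_dirichletSemigroup hf (-l) T hx
  have h2 : 0 ≤ f x - Real.exp (-(-l) * T) * G.dirichletSemigroup Ω T f x := by
    rw [h1]
    refine intervalIntegral.integral_nonneg hT fun t ht => mul_nonneg (Real.exp_pos _).le ?_
    exact G.dirichletSemigroup_nonneg ht.1 (fun y hy => by linarith [h y hy]) x
  rw [neg_neg] at h2
  linarith

/-- Integrate the discounted heat equation over [0,T]; the two boundary terms are the unit mass and
the remainder at time T. -/
theorem truncatedResolvent_equation [DecidableEq V] {Ω : Finset V} (α T : ℝ) {x y : V}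
    (hx : x ∈ Ω) (hy : y ∈ Ω) :
    α * G.truncatedResolvent Ω α T x y - G.laplacian (G.truncatedResolvent Ω α T x) y =
      (if x = y then 1 / G.m y else 0) -
        Real.exp (-α * T) * G.dirichletHeatKernel Ω T x y := by
  have hc := G.continuous_exp_mul_dirichletHeatKernel Ω α x
  have hL : G.laplacian (G.truncatedResolvent Ω α T x) y = ∫ t in (0 : ℝ)..T,
      Real.exp (-α * t) * G.laplacian (fun z => G.dirichletHeatKernel Ω t x z) y := by
    simp only [laplacian, Finset.mul_sum]
    rw [intervalIntegral.integral_finsetSum fun z _ => ?_]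
    · refine Finset.sum_congr rfl fun z _ => ?_
      rw [truncatedResolvent, truncatedResolvent, ← intervalIntegral.integral_sub
        ((hc z).intervalIntegrable _ _) ((hc y).intervalIntegrable _ _),
        ← intervalIntegral.integral_const_mul]
      refine intervalIntegral.integral_congr fun t _ => ?_
      ring
    · refine Continuous.intervalIntegrable ?_ _ _
      have : (fun t : ℝ => Real.exp (-α * t) * (G.w y z / G.m y *
          (G.dirichletHeatKernel Ω t x z - G.dirichletHeatKernel Ω t x y))) =
          fun t : ℝ => G.w y z / G.m y * (Real.exp (-α * t) * G.dirichletHeatKernel Ω t x z -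
            Real.exp (-α * t) * G.dirichletHeatKernel Ω t x y) := by
        ext t; ring
      rw [this]
      exact continuous_const.mul ((hc z).sub (hc y))
  have hd : ∀ t, HasDerivAt (fun t => Real.exp (-α * t) * G.dirichletHeatKernel Ω t x y)
      (Real.exp (-α * t) * G.laplacian (fun z => G.dirichletHeatKernel Ω t x z) y -
        α * (Real.exp (-α * t) * G.dirichletHeatKernel Ω t x y)) t := by
    intro t
    have h1 : HasDerivAt (fun t : ℝ => Real.exp (-α * t)) (Real.exp (-α * t) * (-α)) t := by
      simpa using ((hasDerivAt_id t).const_mul (-α)).exp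
    refine (h1.mul (G.hasDerivAt_dirichletHeatKernel Ω t x hy)).congr_deriv ?_
    ring
  have hcl : Continuous fun t : ℝ => Real.exp (-α * t) *
      G.laplacian (fun z => G.dirichletHeatKernel Ω t x z) y := by
    refine (by fun_prop : Continuous fun t : ℝ => Real.exp (-α * t)).mul ?_
    exact continuous_finsetSum _ fun z _ => continuous_const.mul
      ((G.continuous_dirichletHeatKernel Ω x z).sub (G.continuous_dirichletHeatKernel Ω x y))
  have hcα : Continuous fun t : ℝ => α * (Real.exp (-α * t) * G.dirichletHeatKernel Ω t x y) :=
    continuous_const.mul (hc y)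
  have hI := intervalIntegral.integral_eq_sub_of_hasDerivAt (a := 0) (b := T) (fun t _ => hd t)
    ((hcl.sub hcα).intervalIntegrable _ _)
  rw [intervalIntegral.integral_sub (hcl.intervalIntegrable _ _)
    (hcα.intervalIntegrable _ _), ← hL,
    intervalIntegral.integral_const_mul, G.dirichletHeatKernel_zero Ω hx] at hI
  simp only [mul_zero, Real.exp_zero, one_mul] at hI
  rw [truncatedResolvent]
  have : (if x = y then 1 / G.m y else 0) = @ite ℝ (x = y) (Classical.propDecidable (x = y))
    (1 / G.m y) 0 := by congr
  rw [this]
  linarith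

end Resolvent

/-! ### Quadratic form and Rayleigh quotients on finite supports -/

section Energy

theorem energy_eq {S : Finset V} {f : V → ℝ} (hf : ∀ x ∉ S, f x = 0) :
    G.energy f = ∑ x ∈ S, G.deg x * f x ^ 2 - ∑ x ∈ S, ∑ y ∈ S, G.w x y * (f x * f y) := by
  classical
  -- The energy density also lives on the neighbours of S, where f vanishes; they carry part of the
  -- second copy of the degree term.
  set S' := S ∪ S.biUnion G.nbrs with hS'
  have hterm : ∀ x, ∑ y ∈ G.nbrs x, G.w x y * |f x - f y| ^ 2 =
      G.deg x * f x ^ 2 - 2 * ∑ y ∈ S, G.w x y * (f x * f y) + ∑ y ∈ S, G.w x y * f y ^ 2 := by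
    intro x
    rw [← G.sum_nbrs_eq x (f := fun y => f x * f y) (fun y hy => by simp [hf y hy]),
      ← G.sum_nbrs_eq x (f := fun y => f y ^ 2) (fun y hy => by simp [hf y hy]), deg,
      Finset.sum_mul, Finset.mul_sum, ← Finset.sum_sub_distrib, ← Finset.sum_add_distrib]
    refine Finset.sum_congr rfl fun y _ => ?_
    rw [sq_abs]; ring
  have hzero : ∀ x ∉ S', G.deg x * f x ^ 2 - 2 * ∑ y ∈ S, G.w x y * (f x * f y) +
      ∑ y ∈ S, G.w x y * f y ^ 2 = 0 := by
    intro x hx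
    simp only [hS', Finset.mem_union, Finset.mem_biUnion, not_or, not_exists, not_and] at hx
    have h0 : ∑ y ∈ S, G.w x y * f y ^ 2 = 0 := Finset.sum_eq_zero fun y hy => by
      have := hx.2 y hy
      rw [mem_nbrs] at this
      rw [G.w_symm, G.w_eq_zero y x this, zero_mul]
    rw [h0, hf x hx.1]; simp
  have hsub : S ⊆ S' := Finset.subset_union_left
  have h1 : ∑ x ∈ S', G.deg x * f x ^ 2 = ∑ x ∈ S, G.deg x * f x ^ 2 :=
    (Finset.sum_subset hsub fun x _ hx => by simp [hf x hx]).symm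
  have h2 : ∑ x ∈ S', ∑ y ∈ S, G.w x y * (f x * f y) = ∑ x ∈ S, ∑ y ∈ S, G.w x y * (f x * f y) :=
    (Finset.sum_subset hsub fun x _ hx => by simp [hf x hx]).symm
  have h3 : ∑ x ∈ S', ∑ y ∈ S, G.w x y * f y ^ 2 = ∑ x ∈ S, G.deg x * f x ^ 2 := by
    rw [Finset.sum_comm]
    refine Finset.sum_congr rfl fun y hy => ?_
    rw [deg, Finset.sum_mul]
    have hnb : G.nbrs y ⊆ S' := (Finset.subset_biUnion_of_mem G.nbrs hy).trans
      Finset.subset_union_right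
    rw [← Finset.sum_subset hnb fun x _ hx => ?_]
    · exact Finset.sum_congr rfl fun x _ => by rw [G.w_symm]
    · rw [mem_nbrs] at hx
      rw [G.w_symm, G.w_eq_zero y x hx, zero_mul]
  rw [energy]
  simp only [hterm]
  rw [tsum_eq_sum hzero, Finset.sum_add_distrib, Finset.sum_sub_distrib, ← Finset.mul_sum, h1, h2,
    h3]
  ring

theorem normSq_eq {S : Finset V} {f : V → ℝ} (hf : ∀ x ∉ S, f x = 0) :
    G.normSq f = ∑ x ∈ S, f x ^ 2 * G.m x :=
  tsum_eq_sum fun x hx => by simp [hf x hx]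

theorem energy_nonneg (f : V → ℝ) : 0 ≤ G.energy f :=
  mul_nonneg (by norm_num) (tsum_nonneg fun x => Finset.sum_nonneg fun y _ =>
    mul_nonneg (G.w_nonneg x y) (by positivity))

theorem normSq_nonneg (f : V → ℝ) : 0 ≤ G.normSq f :=
  tsum_nonneg fun x => mul_nonneg (sq_nonneg _) (G.m_pos x).le

theorem normSq_pos {f : V → ℝ} (hf : f.support.Finite) (h0 : f ≠ 0) : 0 < G.normSq f := by
  obtain ⟨x, hx⟩ := Function.ne_iff.1 h0
  rw [G.normSq_eq (S := hf.toFinset) fun y hy => by simpa using hy]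
  refine Finset.sum_pos' (fun y _ => mul_nonneg (sq_nonneg _) (G.m_pos y).le)
    ⟨x, by simpa using hx, mul_pos (by simpa using sq_pos_of_ne_zero hx) (G.m_pos x)⟩

theorem bddBelow_rayleigh (Ω : Set V) : BddBelow {q : ℝ | ∃ f : V → ℝ, f.support.Finite ∧
    f.support ⊆ Ω ∧ f ≠ 0 ∧ q = G.energy f / G.normSq f} := by
  refine ⟨0, ?_⟩
  rintro q ⟨f, -, -, -, rfl⟩
  exact div_nonneg (G.energy_nonneg f) (G.normSq_nonneg f)

theorem bottomSpectrum_mul_normSq_le {f : V → ℝ} (hf : f.support.Finite) :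
    G.bottomSpectrum Set.univ * G.normSq f ≤ G.energy f := by
  by_cases h0 : f = 0
  · subst h0
    simp [normSq, energy]
  · rw [← le_div_iff₀ (G.normSq_pos hf h0)]
    exact csInf_le (G.bddBelow_rayleigh _) ⟨f, hf, Set.subset_univ _, h0, rfl⟩

theorem bottomSpectrum_mul_sum_le {S : Finset V} {f : V → ℝ} (hf : ∀ x ∉ S, f x = 0) :
    G.bottomSpectrum Set.univ * ∑ x ∈ S, f x ^ 2 * G.m x ≤
      ∑ x ∈ S, G.deg x * f x ^ 2 - ∑ x ∈ S, ∑ y ∈ S, G.w x y * (f x * f y) := by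
  rw [← G.normSq_eq hf, ← G.energy_eq hf]
  refine G.bottomSpectrum_mul_normSq_le (S.finite_toSet.subset fun x hx => ?_)
  by_contra h
  exact hx (hf x h)

end Energy

/-! ### The Agmon inequality and absorption of the gradient term -/

section Agmon

/-- The energy of `φ u` in terms of the Laplacian of `u`. -/
theorem energy_mul_eq {S : Finset V} {u : V → ℝ} (φ : V → ℝ) (hu : ∀ x ∉ S, u x = 0) :
    G.energy (fun x => φ x * u x) = ∑ x ∈ S, φ x ^ 2 * u x * -(G.m x * G.laplacian u x) +
      (1 / 2) * ∑ x ∈ S, ∑ y ∈ S, G.w x y * (u x * u y) * (φ x - φ y) ^ 2 := by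
  rw [G.energy_eq (S := S) fun x hx => by simp [hu x hx]]
  simp only [G.mul_laplacian_of_support _ hu]
  have hsymm : ∑ x ∈ S, ∑ y ∈ S, G.w x y * (u x * u y) * φ y ^ 2 =
      ∑ x ∈ S, ∑ y ∈ S, G.w x y * (u x * u y) * φ x ^ 2 := by
    rw [Finset.sum_comm]
    refine Finset.sum_congr rfl fun x _ => Finset.sum_congr rfl fun y _ => ?_
    rw [G.w_symm]; ring
  have h1 : ∑ x ∈ S, ∑ y ∈ S, G.w x y * (u x * u y) * (φ x - φ y) ^ 2 =
      2 * ∑ x ∈ S, ∑ y ∈ S, G.w x y * (u x * u y) * φ x ^ 2 -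
        2 * ∑ x ∈ S, ∑ y ∈ S, G.w x y * (φ x * u x * (φ y * u y)) := by
    rw [two_mul (∑ x ∈ S, ∑ y ∈ S, G.w x y * (u x * u y) * φ x ^ 2)]
    nth_rw 2 [← hsymm]
    simp only [← Finset.sum_add_distrib, Finset.mul_sum, ← Finset.sum_sub_distrib]
    refine Finset.sum_congr rfl fun x _ => Finset.sum_congr rfl fun y _ => ?_
    ring
  have h2 : ∑ x ∈ S, φ x ^ 2 * u x * -(∑ y ∈ S, G.w x y * u y - G.deg x * u x) =
      ∑ x ∈ S, G.deg x * (φ x * u x) ^ 2 - ∑ x ∈ S, ∑ y ∈ S, G.w x y * (u x * u y) * φ x ^ 2 := by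
    rw [← Finset.sum_sub_distrib]
    refine Finset.sum_congr rfl fun x _ => ?_
    have : ∑ y ∈ S, G.w x y * (u x * u y) * φ x ^ 2 = φ x ^ 2 * u x * ∑ y ∈ S, G.w x y * u y := by
      rw [Finset.mul_sum]; exact Finset.sum_congr rfl fun y _ => by ring
    rw [this]; ring
  rw [h1, h2]; ring

theorem agmon_inequality {Ω : Finset V} {α T : ℝ} (hT : 0 ≤ T) {x₀ : V} (hx₀ : x₀ ∈ Ω)
    (φ : V → ℝ) :
    (G.bottomSpectrum Set.univ + α) *
        ∑ x ∈ Ω, (φ x * G.truncatedResolvent Ω α T x₀ x) ^ 2 * G.m x ≤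
      φ x₀ ^ 2 * G.truncatedResolvent Ω α T x₀ x₀ + (1 / 2) * ∑ x ∈ Ω, ∑ y ∈ Ω, G.w x y *
        (G.truncatedResolvent Ω α T x₀ x * G.truncatedResolvent Ω α T x₀ y) *
          (φ x - φ y) ^ 2 := by
  classical
  set u := G.truncatedResolvent Ω α T x₀ with hu
  have hu0 : ∀ x ∉ Ω, u x = 0 := fun x hx => G.truncatedResolvent_of_notMem_right hx α T x₀
  have hupos : ∀ x, 0 ≤ u x := G.truncatedResolvent_nonneg Ω α hT x₀
  have hE := G.bottomSpectrum_mul_sum_le (S := Ω) (f := fun x => φ x * u x)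
    fun x hx => by simp [hu0 x hx]
  rw [← G.energy_eq fun x hx => by simp [hu0 x hx], G.energy_mul_eq φ hu0] at hE
  have hΔ : ∑ x ∈ Ω, φ x ^ 2 * u x * -(G.m x * G.laplacian u x) ≤
      ∑ x ∈ Ω, ((if x₀ = x then φ x₀ ^ 2 * u x₀ else 0) - α * ((φ x * u x) ^ 2 * G.m x)) := by
    refine Finset.sum_le_sum fun x hx => ?_
    have h := G.truncatedResolvent_equation α T hx₀ hx
    rw [← hu] at h
    have hm := G.m_pos x
    have hp := mul_nonneg (Real.exp_pos (-α * T)).le (G.dirichletHeatKernel_nonneg Ω hT x₀ x)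
    -- The remainder at time T has the favourable sign and is dropped.
    have h3 : 0 ≤ φ x ^ 2 * u x * G.m x * (Real.exp (-α * T) * G.dirichletHeatKernel Ω T x₀ x) :=
      mul_nonneg (mul_nonneg (mul_nonneg (sq_nonneg _) (hupos x)) hm.le) hp
    have h4 : -G.laplacian u x = (if x₀ = x then 1 / G.m x else 0) -
        Real.exp (-α * T) * G.dirichletHeatKernel Ω T x₀ x - α * u x := by linarith
    have h5 : φ x ^ 2 * u x * -(G.m x * G.laplacian u x) =
        φ x ^ 2 * u x * G.m x * -G.laplacian u x := by ring
    rw [h5, h4]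
    split_ifs with h6
    · subst h6
      have : φ x₀ ^ 2 * u x₀ * G.m x₀ * (1 / G.m x₀) = φ x₀ ^ 2 * u x₀ := by field_simp
      nlinarith
    · nlinarith
  rw [Finset.sum_sub_distrib, Finset.sum_ite_eq, if_pos hx₀, ← Finset.mul_sum] at hΔ
  linarith

/-- With φ = 1 the Agmon inequality gives λ m(x₀) u(x₀)² ≤ u(x₀). The bound depends on neither Ω nor
T. -/
theorem truncatedResolvent_self_le {α : ℝ} (hα : 0 < G.bottomSpectrum Set.univ + α)
    {Ω : Finset V} {T : ℝ} (hT : 0 ≤ T) {x₀ : V} (hx₀ : x₀ ∈ Ω) :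
    G.truncatedResolvent Ω α T x₀ x₀ ≤ 1 / ((G.bottomSpectrum Set.univ + α) * G.m x₀) := by
  have h := G.agmon_inequality (α := α) hT hx₀ fun _ => 1
  set u := G.truncatedResolvent Ω α T x₀ with hu
  have hm := G.m_pos x₀
  have h1 : u x₀ ^ 2 * G.m x₀ ≤ ∑ x ∈ Ω, (1 * u x) ^ 2 * G.m x := by
    have := Finset.single_le_sum (f := fun x => (1 * u x) ^ 2 * G.m x)
      (fun x _ => mul_nonneg (sq_nonneg _) (G.m_pos x).le) hx₀
    simpa using this
  simp only [sub_self, ne_eq, OfNat.ofNat_ne_zero, not_false_eq_true, zero_pow, mul_zero,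
    Finset.sum_const_zero, add_zero, one_pow, one_mul] at h h1
  have h2 : (G.bottomSpectrum Set.univ + α) * (u x₀ ^ 2 * G.m x₀) ≤ u x₀ :=
    (mul_le_mul_of_nonneg_left h1 hα.le).trans h
  rw [le_div_iff₀ (mul_pos hα hm)]
  by_contra hcon
  push Not at hcon
  have h0 : 0 < u x₀ := by
    by_contra h3
    have : u x₀ * ((G.bottomSpectrum Set.univ + α) * G.m x₀) ≤ 0 :=
      mul_nonpos_of_nonpos_of_nonneg (not_lt.1 h3) (mul_pos hα hm).le
    linarith
  nlinarith [mul_lt_mul_of_pos_left hcon h0]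

/-- By `h2` the gradient term comes only from edges inside B, and by `h1`, `h3` it is at most λ ∑_B
(φu)²m. Subtracting this from the left side leaves the sum outside B; no strict inequality is
needed, so the critical exponent is allowed. -/
theorem weighted_sum_le {α T : ℝ} (hα : 0 < G.bottomSpectrum Set.univ + α) (hT : 0 ≤ T)
    {Ω : Finset V} {x₀ : V} (hx₀ : x₀ ∈ Ω)
    {φ : V → ℝ} (hφ : ∀ x, 0 ≤ φ x) {κ : V → V → ℝ} {B : Set V}
    (h1 : ∀ x y, G.graph.Adj x y → (φ x - φ y) ^ 2 ≤ κ x y * (φ x * φ y))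
    (h2 : ∀ x y, G.graph.Adj x y → ¬(x ∈ B ∧ y ∈ B) → φ x = φ y)
    (h3 : ∀ (S : Finset V) (v : V → ℝ), (∀ x, 0 ≤ v x) →
      (1 / 2) * ∑ x ∈ S, ∑ y ∈ S, G.w x y * (κ x y * (v x * v y)) ≤
        (G.bottomSpectrum Set.univ + α) * ∑ x ∈ S, v x ^ 2 * G.m x)
    (S : Finset V) (hS : ∀ x ∈ S, x ∉ B) :
    (G.bottomSpectrum Set.univ + α) *
        ∑ x ∈ S, (φ x * G.truncatedResolvent Ω α T x₀ x) ^ 2 * G.m x ≤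
      φ x₀ ^ 2 * G.truncatedResolvent Ω α T x₀ x₀ := by
  classical
  have hA := G.agmon_inequality (α := α) hT hx₀ φ
  set u := G.truncatedResolvent Ω α T x₀ with hu
  have hu0 : ∀ x ∉ Ω, u x = 0 := fun x hx => G.truncatedResolvent_of_notMem_right hx α T x₀
  have hupos : ∀ x, 0 ≤ u x := G.truncatedResolvent_nonneg Ω α hT x₀
  set F : V → ℝ := fun x => (φ x * u x) ^ 2 * G.m x with hF
  have hF0 : ∀ x, 0 ≤ F x := fun x => mul_nonneg (sq_nonneg _) (G.m_pos x).le
  have hB := h3 (Ω.filter (· ∈ B)) (fun x => φ x * u x) fun x => mul_nonneg (hφ x) (hupos x)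
  have hterm : ∀ x y, G.w x y * (u x * u y) * (φ x - φ y) ^ 2 ≤
      if x ∈ B then (if y ∈ B then G.w x y * (κ x y * (φ x * u x * (φ y * u y))) else 0)
        else 0 := by
    intro x y
    by_cases hxy : G.graph.Adj x y
    · by_cases hb : x ∈ B ∧ y ∈ B
      · rw [if_pos hb.1, if_pos hb.2]
        calc G.w x y * (u x * u y) * (φ x - φ y) ^ 2
            ≤ G.w x y * (u x * u y) * (κ x y * (φ x * φ y)) :=
              mul_le_mul_of_nonneg_left (h1 x y hxy)
                (mul_nonneg (G.w_nonneg x y) (mul_nonneg (hupos x) (hupos y)))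
          _ = _ := by ring
      · rw [h2 x y hxy hb, sub_self]
        split_ifs with hx hy
        · exact absurd ⟨hx, hy⟩ hb
        · simp
        · simp
    · rw [G.w_eq_zero x y hxy]; simp
  have hsum : ∑ x ∈ Ω, ∑ y ∈ Ω, G.w x y * (u x * u y) * (φ x - φ y) ^ 2 ≤
      ∑ x ∈ Ω.filter (· ∈ B), ∑ y ∈ Ω.filter (· ∈ B),
        G.w x y * (κ x y * (φ x * u x * (φ y * u y))) := by
    rw [Finset.sum_filter]
    refine Finset.sum_le_sum fun x _ => ?_
    refine (Finset.sum_le_sum fun y _ => hterm x y).trans_eq ?_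
    split_ifs with hx
    · rw [Finset.sum_filter]
    · simp
  have hsplit := Finset.sum_filter_add_sum_filter_not Ω (· ∈ B) F
  have hSle : ∑ x ∈ S, F x ≤ ∑ x ∈ Ω.filter (· ∉ B), F x := by
    have : ∑ x ∈ S, F x = ∑ x ∈ S.filter (· ∈ Ω), F x := by
      rw [Finset.sum_filter]
      refine Finset.sum_congr rfl fun x _ => ?_
      split_ifs with hx
      · rfl
      · simp [hF, hu0 x hx]
    rw [this]
    refine Finset.sum_le_sum_of_subset_of_nonneg (fun x hx => ?_) fun x _ _ => hF0 x
    rw [Finset.mem_filter] at hx ⊢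
    exact ⟨hx.2, hS x hx.1⟩
  have h4 := mul_le_mul_of_nonneg_left hSle hα.le
  have h5 : (G.bottomSpectrum Set.univ + α) * ∑ x ∈ Ω, F x =
      (G.bottomSpectrum Set.univ + α) * ∑ x ∈ Ω.filter (· ∈ B), F x +
        (G.bottomSpectrum Set.univ + α) * ∑ x ∈ Ω.filter (· ∉ B), F x := by
    rw [← hsplit, mul_add]
  linarith

end Agmon

/-! ### From an exponential weight to decay on annuli -/

open Filter Topology

theorem IsAdmissibleMetric.le_jumpSize {G : WeightedGraph V} {ρ : V → V → ℝ}
    (hρ : G.IsAdmissibleMetric ρ) {x y : V} (h : G.graph.Adj x y) : ρ x y ≤ G.jumpSize ρ :=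
  le_csSup hρ.bddAbove_jump ⟨x, y, h, rfl⟩

/-- If all jumps were zero, connectedness would put every vertex in one ball, which is finite. -/
theorem IsAdmissibleMetric.jumpSize_pos [Infinite V] {G : WeightedGraph V} {ρ : V → V → ℝ}
    (hρ : G.IsAdmissibleMetric ρ) : 0 < G.jumpSize ρ := by
  by_contra hs
  have hadj : ∀ x y, G.graph.Adj x y → ρ x y = 0 := fun x y h =>
    le_antisymm ((hρ.le_jumpSize h).trans (not_lt.1 hs)) (hρ.nonneg x y)
  have hwalk : ∀ {x y : V}, G.graph.Walk x y → ρ x y = 0 := by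
    intro x y p
    induction p with
    | nil => exact hρ.self _
    | cons h _ ih =>
      refine le_antisymm ?_ (hρ.nonneg _ _)
      exact (hρ.triangle _ _ _).trans_eq (by rw [hadj _ _ h, ih, add_zero])
  obtain ⟨x₀⟩ := (inferInstance : Nonempty V)
  have h := hρ.finite_ball x₀ 1 one_pos
  refine Set.infinite_univ (α := V) (h.subset fun y _ => ?_)
  obtain ⟨p⟩ := G.connected.preconnected y x₀
  simp [hwalk p]

/-- The exhaustion of the graph by balls of an admissible metric. -/
noncomputable def IsAdmissibleMetric.ball {G : WeightedGraph V} {ρ : V → V → ℝ}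
    (hρ : G.IsAdmissibleMetric ρ) (x₀ : V) (n : ℕ) : Finset V :=
  -- Radius n + 1 because finiteness of balls is only assumed for positive radii.
  (hρ.finite_ball x₀ (n + 1) (by positivity)).toFinset

theorem IsAdmissibleMetric.mem_ball {G : WeightedGraph V} {ρ : V → V → ℝ}
    (hρ : G.IsAdmissibleMetric ρ) {x₀ x : V} {n : ℕ} : x ∈ hρ.ball x₀ n ↔ ρ x x₀ ≤ n + 1 := by
  simp [ball]

theorem IsAdmissibleMetric.ball_mono {G : WeightedGraph V} {ρ : V → V → ℝ}
    (hρ : G.IsAdmissibleMetric ρ) (x₀ : V) : Monotone (hρ.ball x₀) := by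
  intro n k hnk x hx
  rw [hρ.mem_ball] at hx ⊢
  have : (n : ℝ) ≤ k := by exact_mod_cast hnk
  linarith

theorem IsAdmissibleMetric.exists_mem_ball {G : WeightedGraph V} {ρ : V → V → ℝ}
    (hρ : G.IsAdmissibleMetric ρ) (x₀ x : V) : ∃ n, x ∈ hρ.ball x₀ n := by
  obtain ⟨n, hn⟩ := exists_nat_ge (ρ x x₀)
  exact ⟨n, hρ.mem_ball.2 (by linarith)⟩

theorem IsAdmissibleMetric.center_mem_ball {G : WeightedGraph V} {ρ : V → V → ℝ}
    (hρ : G.IsAdmissibleMetric ρ) (x₀ : V) (n : ℕ) : x₀ ∈ hρ.ball x₀ n := by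
  rw [hρ.mem_ball, hρ.self]; positivity

theorem resolventSqSum_le {Ω : ℕ → Finset V} (hmono : Monotone Ω) (hex : ∀ x, ∃ n, x ∈ Ω n)
    (α : ℝ) (x₀ : V) (A : Set V) {C : ℝ}
    (h : ∀ (n : ℕ) (S : Finset V), (∀ x ∈ S, x ∈ A) →
      ∑ x ∈ S, G.truncatedResolvent (Ω n) α n x₀ x ^ 2 * G.m x ≤ C) :
    G.resolventSqSum α x₀ A ≤ ENNReal.ofReal C := by
  classical
  rw [resolventSqSum, ENNReal.tsum_eq_iSup_sum]
  refine iSup_le fun S => ?_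
  have hlim : Tendsto (fun n : ℕ => ∑ x ∈ S,
      ENNReal.ofReal (G.truncatedResolvent (Ω n) α n x₀ x) ^ 2 * ENNReal.ofReal (G.m x)) atTop
      (𝓝 (∑ x ∈ S, G.resolventKernel α x₀ x ^ 2 * ENNReal.ofReal (G.m x))) := by
    refine tendsto_finsetSum _ fun x _ => ?_
    exact ENNReal.Tendsto.mul_const ((ENNReal.continuous_pow 2).continuousAt.tendsto.comp
      (G.tendsto_truncatedResolvent hmono hex α x₀ x)) (Or.inr ENNReal.ofReal_ne_top)
  refine le_of_tendsto' hlim fun n => ?_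
  have hn : (0 : ℝ) ≤ n := n.cast_nonneg
  have h1 := h n (S.map (Function.Embedding.subtype _)) (by
    intro x hx
    rw [Finset.mem_map] at hx
    obtain ⟨y, -, rfl⟩ := hx
    exact y.2)
  rw [Finset.sum_map] at h1
  refine le_trans (le_of_eq ?_) (ENNReal.ofReal_le_ofReal h1)
  rw [ENNReal.ofReal_sum_of_nonneg fun x _ => mul_nonneg (sq_nonneg _) (G.m_pos _).le]
  refine Finset.sum_congr rfl fun x _ => ?_
  rw [ENNReal.ofReal_mul (sq_nonneg _), ENNReal.ofReal_pow (G.truncatedResolvent_nonneg _ _ hn _ _)]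
  rfl

/-- The common core for both kinds of metric: `hκ` is the edge inequality for the exponential weight
divided by φ(y)², and `h3` says that κ is small enough to be absorbed. The outer radius plays no
role. -/
theorem exists_resolventSqSum_le {ρ : V → V → ℝ} (hρ : G.IsAdmissibleMetric ρ) {α a s : ℝ}
    (hα : 0 < G.bottomSpectrum Set.univ + α) (ha : 0 ≤ a) (hs0 : 0 ≤ s)
    (hs : ∀ x y, G.graph.Adj x y → ρ x y ≤ s) {κ : V → V → ℝ}
    (hκ : ∀ x y, G.graph.Adj x y → ∀ δ, |δ| ≤ ρ x y →
      (Real.exp (a * δ) - 1) ^ 2 ≤ κ x y * Real.exp (a * δ))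
    (h3 : ∀ (S : Finset V) (v : V → ℝ), (∀ x, 0 ≤ v x) →
      (1 / 2) * ∑ x ∈ S, ∑ y ∈ S, G.w x y * (κ x y * (v x * v y)) ≤
        (G.bottomSpectrum Set.univ + α) * ∑ x ∈ S, v x ^ 2 * G.m x) (x₀ : V) :
    ∃ C : ℝ, ∀ R R' : ℝ, G.resolventSqSum α x₀ (annulus ρ x₀ R R') ≤
      ENNReal.ofReal (C * Real.exp (-2 * a * R)) := by
  set l := G.bottomSpectrum Set.univ + α with hl
  have hm := G.m_pos x₀
  refine ⟨Real.exp (2 * a * s) / (l * (l * G.m x₀)), fun R R' => ?_⟩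
  refine G.resolventSqSum_le (hρ.ball_mono x₀) (hρ.exists_mem_ball x₀) α x₀ _ fun n S hS => ?_
  have hn : (0 : ℝ) ≤ n := n.cast_nonneg
  have hx₀ := hρ.center_mem_ball x₀ n
  set Ω := hρ.ball x₀ n
  -- Capping at R − s rather than R makes φ constant across edges that leave {ρ < R}; the price is
  -- the factor e^{2as} in C.
  set φ : V → ℝ := fun x => Real.exp (a * min (ρ x x₀) (R - s)) with hφ
  have hlip : ∀ x y, G.graph.Adj x y → |ρ x x₀ - ρ y x₀| ≤ ρ x y := by
    intro x y _
    rw [abs_sub_le_iff]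
    have h1 := hρ.triangle x y x₀
    have h2 := hρ.triangle y x x₀
    rw [hρ.symm y x] at h2
    constructor <;> linarith
  have h1 : ∀ x y, G.graph.Adj x y → (φ x - φ y) ^ 2 ≤ κ x y * (φ x * φ y) := by
    intro x y hxy
    set δ := min (ρ x x₀) (R - s) - min (ρ y x₀) (R - s) with hδ
    have hδ' : |δ| ≤ ρ x y := (abs_min_sub_min_le_max _ _ _ _).trans (by
      exact max_le (hlip x y hxy) (by simpa using hρ.nonneg x y))
    have hxφ : φ x = φ y * Real.exp (a * δ) := by
      simp only [hφ, ← Real.exp_add, hδ]; ring_nf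
    have := mul_le_mul_of_nonneg_left (hκ x y hxy δ hδ') (sq_nonneg (φ y))
    rw [hxφ]
    nlinarith
  have h2 : ∀ x y, G.graph.Adj x y → ¬(x ∈ {x | ρ x x₀ < R} ∧ y ∈ {x | ρ x x₀ < R}) →
      φ x = φ y := by
    intro x y hxy hB
    have hb := abs_sub_le_iff.1 (hlip x y hxy)
    have hs' := hs x y hxy
    have h0 := hρ.nonneg x y
    have : R - s ≤ ρ x x₀ ∧ R - s ≤ ρ y x₀ := by
      by_contra hcon
      apply hB
      simp only [Set.mem_ofPred_eq]
      by_cases hx : R - s ≤ ρ x x₀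
      · have hy : ρ y x₀ < R - s := lt_of_not_ge fun hy => hcon ⟨hx, hy⟩
        constructor <;> linarith
      · constructor <;> linarith
    simp only [hφ, min_eq_right this.1, min_eq_right this.2]
  have hW := G.weighted_sum_le hα hn hx₀ (fun x => (Real.exp_pos _).le) h1 h2 h3 S
    fun x hx hxB => absurd (hS x hx).1 (not_le.2 hxB)
  have hself := G.truncatedResolvent_self_le hα hn hx₀
  set u := G.truncatedResolvent Ω α n x₀ with hu
  have hφ0 : φ x₀ ^ 2 ≤ 1 := by
    have : φ x₀ ≤ 1 := Real.exp_le_one_iff.2 (mul_nonpos_of_nonneg_of_nonpos ha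
      ((min_le_left _ _).trans_eq (hρ.self x₀)))
    exact pow_le_one₀ (Real.exp_pos _).le this
  have hu0 : 0 ≤ u x₀ := G.truncatedResolvent_nonneg Ω α hn x₀ x₀
  have hφS : ∀ x ∈ S, φ x = Real.exp (a * (R - s)) := by
    intro x hx
    have := (hS x hx).1
    simp only [hφ]
    rw [min_eq_right (by linarith)]
  have hsum : ∑ x ∈ S, (φ x * u x) ^ 2 * G.m x =
      Real.exp (a * (R - s)) ^ 2 * ∑ x ∈ S, u x ^ 2 * G.m x := by
    rw [Finset.mul_sum]
    exact Finset.sum_congr rfl fun x hx => by rw [hφS x hx]; ring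
  rw [hsum] at hW
  have hE : Real.exp (a * (R - s)) ^ 2 * (Real.exp (2 * a * s) * Real.exp (-2 * a * R)) = 1 := by
    rw [← Real.exp_nat_mul, ← Real.exp_add, ← Real.exp_add, ← Real.exp_zero]
    congr 1; push_cast; ring
  have hfin : l * (Real.exp (a * (R - s)) ^ 2 * ∑ x ∈ S, u x ^ 2 * G.m x) ≤ 1 / (l * G.m x₀) :=
    hW.trans ((mul_le_of_le_one_left hu0 hφ0).trans hself)
  have hEpos : 0 < Real.exp (2 * a * s) * Real.exp (-2 * a * R) := by positivity
  calc ∑ x ∈ S, u x ^ 2 * G.m x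
      = (Real.exp (2 * a * s) * Real.exp (-2 * a * R)) / l *
        (l * (Real.exp (a * (R - s)) ^ 2 * ∑ x ∈ S, u x ^ 2 * G.m x)) := by
        rw [div_mul_eq_mul_div, eq_div_iff hα.ne']
        linear_combination (-(l * ∑ x ∈ S, u x ^ 2 * G.m x)) * hE
    _ ≤ (Real.exp (2 * a * s) * Real.exp (-2 * a * R)) / l * (1 / (l * G.m x₀)) :=
        mul_le_mul_of_nonneg_left hfin (by positivity)
    _ = _ := by field_simp

/-! ### The two choices of exponent -/

/-- Test with the indicator of the edge {x, y}: its own weight is missing from the energy. -/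
theorem bottomSpectrum_lt_one {x y : V} (hxy : G.graph.Adj x y) (hdeg : ∀ x, G.deg x ≤ G.m x) :
    G.bottomSpectrum Set.univ < 1 := by
  classical
  have hne : x ≠ y := hxy.ne
  have h := G.bottomSpectrum_mul_sum_le (S := {x, y})
    (f := fun z => if z ∈ ({x, y} : Finset V) then 1 else 0) fun z hz => if_neg hz
  have hw := G.w_pos x y hxy
  have hxx : G.w x x = 0 := G.w_eq_zero x x (G.graph.loopless.irrefl x)
  have hyy : G.w y y = 0 := G.w_eq_zero y y (G.graph.loopless.irrefl y)
  simp [Finset.sum_pair hne, hxx, hyy, G.w_symm y x] at h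
  have := hdeg x
  have := hdeg y
  have := G.m_pos x
  have := G.m_pos y
  by_contra hcon
  push Not at hcon
  nlinarith

theorem exp_log_inv_add_log_sqrt {q : ℝ} (h0 : 0 < q) :
    Real.exp (Real.log q⁻¹ + Real.log (1 + Real.sqrt (1 - q ^ 2))) =
      (1 + Real.sqrt (1 - q ^ 2)) / q := by
  have : 0 < 1 + Real.sqrt (1 - q ^ 2) := by positivity
  rw [Real.exp_add, Real.exp_log (inv_pos.2 h0), Real.exp_log this]
  field_simp

/-- The two logarithms add up to arcosh(1/q). This is the form in which the exponent for the
combinatorial distance is used. -/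
theorem mul_cosh_log_inv_add_log_sqrt {q : ℝ} (h0 : 0 < q) (h1 : q ≤ 1) :
    q * Real.cosh (Real.log q⁻¹ + Real.log (1 + Real.sqrt (1 - q ^ 2))) = 1 := by
  have : 0 < 1 + Real.sqrt (1 - q ^ 2) := by positivity
  have hs := Real.sq_sqrt (show 0 ≤ 1 - q ^ 2 by nlinarith)
  rw [Real.cosh_eq, Real.exp_neg, exp_log_inv_add_log_sqrt h0]
  field_simp
  nlinarith

/-- Schur test: 2 v(x)v(y) ≤ v(x)² + v(y)², then symmetry. -/
theorem sum_sum_mul_le (S : Finset V) (c : V → V → ℝ) (hc : ∀ x y, 0 ≤ c x y)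
    (hsymm : ∀ x y, c x y = c y x) (v : V → ℝ) :
    ∑ x ∈ S, ∑ y ∈ S, G.w x y * (c x y * (v x * v y)) ≤
      ∑ x ∈ S, (∑ y ∈ G.nbrs x, G.w x y * c x y) * v x ^ 2 := by
  classical
  have h1 : ∑ x ∈ S, ∑ y ∈ S, G.w x y * c x y * v y ^ 2 =
      ∑ x ∈ S, ∑ y ∈ S, G.w x y * c x y * v x ^ 2 := by
    rw [Finset.sum_comm]
    refine Finset.sum_congr rfl fun x _ => Finset.sum_congr rfl fun y _ => ?_
    rw [G.w_symm, hsymm]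
  have h2 : ∑ x ∈ S, ∑ y ∈ S, G.w x y * (c x y * (v x * v y)) ≤
      ∑ x ∈ S, ∑ y ∈ S, G.w x y * c x y * v x ^ 2 := by
    have : ∑ x ∈ S, ∑ y ∈ S, G.w x y * (c x y * (v x * v y)) ≤
        ∑ x ∈ S, ∑ y ∈ S, (1 / 2 * (G.w x y * c x y * v x ^ 2) +
          1 / 2 * (G.w x y * c x y * v y ^ 2)) := by
      refine Finset.sum_le_sum fun x _ => Finset.sum_le_sum fun y _ => ?_
      have := mul_nonneg (mul_nonneg (G.w_nonneg x y) (hc x y)) (sq_nonneg (v x - v y))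
      nlinarith
    refine this.trans_eq ?_
    simp only [Finset.sum_add_distrib, ← Finset.mul_sum] at h1 ⊢
    linarith
  refine h2.trans (Finset.sum_le_sum fun x _ => ?_)
  rw [← Finset.sum_mul]
  refine mul_le_mul_of_nonneg_right ?_ (sq_nonneg _)
  have : ∑ y ∈ S, G.w x y * c x y = ∑ y ∈ S.filter (· ∈ G.nbrs x), G.w x y * c x y := by
    rw [Finset.sum_filter]
    refine Finset.sum_congr rfl fun y _ => ?_
    split_ifs with h
    · rfl
    · rw [G.w_eq_zero x y (by rwa [mem_nbrs] at h), zero_mul]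
  rw [this]
  exact Finset.sum_le_sum_of_subset_of_nonneg (fun y hy => (Finset.mem_filter.1 hy).2)
    fun y _ _ => mul_nonneg (G.w_nonneg x y) (hc x y)

/-- The energy is the degree form minus the adjacency form, and the degree form is at most the norm;
so a spectral gap bounds the adjacency form. -/
theorem sum_sum_mul_le_one_sub (hdeg : ∀ x, G.deg x ≤ G.m x) (S : Finset V) (v : V → ℝ) :
    ∑ x ∈ S, ∑ y ∈ S, G.w x y * (v x * v y) ≤
      (1 - G.bottomSpectrum Set.univ) * ∑ x ∈ S, v x ^ 2 * G.m x := by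
  classical
  have h := G.bottomSpectrum_mul_sum_le (S := S) (f := fun x => if x ∈ S then v x else 0)
    fun x hx => if_neg hx
  have h1 : ∑ x ∈ S, (if x ∈ S then v x else 0) ^ 2 * G.m x = ∑ x ∈ S, v x ^ 2 * G.m x :=
    Finset.sum_congr rfl fun x hx => by rw [if_pos hx]
  have h2 : ∑ x ∈ S, G.deg x * (if x ∈ S then v x else 0) ^ 2 ≤ ∑ x ∈ S, v x ^ 2 * G.m x :=
    Finset.sum_le_sum fun x hx => by
      rw [if_pos hx, mul_comm]
      exact mul_le_mul_of_nonneg_left (hdeg x) (sq_nonneg _)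
  have h3 : ∑ x ∈ S, ∑ y ∈ S, G.w x y *
      ((if x ∈ S then v x else 0) * (if y ∈ S then v y else 0)) =
      ∑ x ∈ S, ∑ y ∈ S, G.w x y * (v x * v y) :=
    Finset.sum_congr rfl fun x hx => Finset.sum_congr rfl fun y hy => by rw [if_pos hx, if_pos hy]
  rw [h1, h3] at h
  linarith

/-- With κ = 2λρ² the intrinsic condition gives exactly the absorption bound, so what is needed is
|e^{aδ} − 1| ≤ ρ√(2λ) for 0 ≤ δ ≤ ρ ≤ s. -/
theorem exists_decay_of_ne_combDist [Infinite V] {ρ : V → V → ℝ} (hρ : G.IsAdmissibleMetric ρ)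
    (hne : ρ ≠ G.combDist) {α : ℝ} (hα : 0 < G.bottomSpectrum Set.univ + α) (x₀ : V) :
    ∃ C : ℝ, ∀ R R' : ℝ, G.resolventSqSum α x₀ (annulus ρ x₀ R R') ≤ ENNReal.ofReal
      (C * Real.exp (-2 * G.decayExponent ρ (-α) (G.bottomSpectrum Set.univ) * R)) := by
  set l := G.bottomSpectrum Set.univ + α with hl
  have hs := hρ.jumpSize_pos
  set s := G.jumpSize ρ with hs'
  set a := G.decayExponent ρ (-α) (G.bottomSpectrum Set.univ) with ha'
  have hsq : 0 ≤ s * Real.sqrt (2 * l) := by positivity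
  have ha : a = 1 / s * Real.log (1 + s * Real.sqrt (2 * l)) := by
    rw [ha', decayExponent, if_neg hne, sub_neg_eq_add]
  have ha0 : 0 ≤ a := by
    rw [ha]
    exact mul_nonneg (by positivity) (Real.log_nonneg (by linarith))
  have hexp : Real.exp (a * s) = 1 + s * Real.sqrt (2 * l) := by
    rw [ha, mul_comm, ← mul_assoc, mul_one_div_cancel hs.ne', one_mul, Real.exp_log (by linarith)]
  refine G.exists_resolventSqSum_le (κ := fun x y => 2 * l * ρ x y ^ 2) hρ hα ha0 hs.le
    (fun x y h => hρ.le_jumpSize h) (fun x y hxy δ hδ => ?_) (fun S v _ => ?_) x₀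
  · set r := ρ x y
    have hr0 : 0 ≤ r := hρ.nonneg x y
    have hrs : r ≤ s := hρ.le_jumpSize hxy
    -- The exponential lies below its chord over [0, s], and a is chosen so that the chord has slope
    -- √(2λ).
    have hconv : Real.exp (a * r) ≤ 1 + r * Real.sqrt (2 * l) := by
      have h := convexOn_exp.2 (Set.mem_univ (0 : ℝ)) (Set.mem_univ (a * s))
        (show 0 ≤ 1 - r / s by rw [sub_nonneg, div_le_one hs]; exact hrs)
        (show 0 ≤ r / s by positivity) (by ring)
      simp only [smul_eq_mul, mul_zero, zero_add, Real.exp_zero, mul_one, hexp] at h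
      have e1 : r / s * (a * s) = a * r := by field_simp
      have e2 : 1 - r / s + r / s * (1 + s * Real.sqrt (2 * l)) = 1 + r * Real.sqrt (2 * l) := by
        field_simp; ring
      rwa [e1, e2] at h
    have hpos : ∀ d : ℝ, 0 ≤ d → d ≤ r → (Real.exp (a * d) - 1) ^ 2 ≤ 2 * l * r ^ 2 := by
      intro d hd hdr
      have h1 : Real.exp (a * d) ≤ 1 + r * Real.sqrt (2 * l) :=
        (Real.exp_le_exp.2 (mul_le_mul_of_nonneg_left hdr ha0)).trans hconv
      have h2 : 1 ≤ Real.exp (a * d) := Real.one_le_exp (mul_nonneg ha0 hd)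
      calc (Real.exp (a * d) - 1) ^ 2 ≤ (r * Real.sqrt (2 * l)) ^ 2 :=
            pow_le_pow_left₀ (by linarith) (by linarith) 2
        _ = 2 * l * r ^ 2 := by
            rw [mul_pow, Real.sq_sqrt (by linarith)]; ring
    rw [abs_le] at hδ
    have hK : 0 ≤ 2 * l * r ^ 2 := by positivity
    rcases le_total 0 δ with h | h
    · refine (hpos δ h hδ.2).trans (le_mul_of_one_le_right hK ?_)
      exact Real.one_le_exp (mul_nonneg ha0 h)
    · have h1 := hpos (-δ) (by linarith) (by linarith)
      have he : Real.exp (a * δ) * Real.exp (a * -δ) = 1 := by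
        rw [← Real.exp_add, ← Real.exp_zero]; congr 1; ring
      have he1 : Real.exp (a * δ) ≤ 1 := Real.exp_le_one_iff.2 (mul_nonpos_of_nonneg_of_nonpos ha0 h)
      have he0 := Real.exp_pos (a * δ)
      calc (Real.exp (a * δ) - 1) ^ 2
          = Real.exp (a * δ) ^ 2 * (Real.exp (a * -δ) - 1) ^ 2 := by
            rw [← mul_pow, mul_sub, he, mul_one]; ring
        _ ≤ Real.exp (a * δ) ^ 2 * (2 * l * r ^ 2) :=
            mul_le_mul_of_nonneg_left h1 (sq_nonneg _)
        _ ≤ _ := by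
            rw [mul_comm]
            refine mul_le_mul_of_nonneg_left ?_ hK
            rw [sq]; exact mul_le_of_le_one_left he0.le he1
  · have h := G.sum_sum_mul_le S (fun x y => ρ x y ^ 2) (fun x y => sq_nonneg _)
      (fun x y => by rw [hρ.symm]) v
    have h2 : ∑ x ∈ S, (∑ y ∈ G.nbrs x, G.w x y * ρ x y ^ 2) * v x ^ 2 ≤
        ∑ x ∈ S, v x ^ 2 * G.m x := Finset.sum_le_sum fun x _ => by
      rw [mul_comm]
      exact mul_le_mul_of_nonneg_left (hρ.intrinsic x) (sq_nonneg _)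
    have h3 : ∑ x ∈ S, ∑ y ∈ S, G.w x y * (2 * l * ρ x y ^ 2 * (v x * v y)) =
        2 * l * ∑ x ∈ S, ∑ y ∈ S, G.w x y * (ρ x y ^ 2 * (v x * v y)) := by
      simp only [Finset.mul_sum]
      exact Finset.sum_congr rfl fun x _ => Finset.sum_congr rfl fun y _ => by ring
    rw [h3]
    have := mul_le_mul_of_nonneg_left (h.trans h2) hα.le
    linarith

theorem combDist_of_adj {x y : V} (h : G.graph.Adj x y) : G.combDist x y = 1 := by
  rw [combDist, SimpleGraph.dist_eq_one_iff_adj.2 h, Nat.cast_one]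

theorem decayExponent_combDist (μ t : ℝ) : G.decayExponent G.combDist μ t =
    Real.log ((1 - t) / (1 - μ))⁻¹ +
      Real.log (1 + Real.sqrt (1 - ((1 - t) / (1 - μ)) ^ 2)) := by
  rw [decayExponent, if_pos rfl, inv_div]

/-- Here κ = 2(cosh a − 1) is constant, and the adjacency form is bounded by 1 − μ₁. Since (1 − μ₁)
cosh a = 1 + α, the product (cosh a − 1)(1 − μ₁) is exactly μ₁ + α. -/
theorem exists_decay_of_combDist [Infinite V] (hρ : G.IsAdmissibleMetric G.combDist) {α : ℝ}
    (h0 : 0 < G.bottomSpectrum Set.univ) (hα : 0 ≤ α) (x₀ : V) :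
    ∃ C : ℝ, ∀ R R' : ℝ, G.resolventSqSum α x₀ (annulus G.combDist x₀ R R') ≤ ENNReal.ofReal
      (C * Real.exp (-2 * G.decayExponent G.combDist (-α) (G.bottomSpectrum Set.univ) * R)) := by
  have hdeg : ∀ x, G.deg x ≤ G.m x := fun x => by
    refine le_trans (le_of_eq ?_) (hρ.intrinsic x)
    refine Finset.sum_congr rfl fun y hy => ?_
    rw [G.combDist_of_adj ((G.mem_nbrs).1 hy)]; ring
  obtain ⟨z, hz⟩ : ∃ z, G.graph.Adj x₀ z :=
    (G.connected.preconnected.exists_adj_of_nontrivial x₀)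
  have h1 := G.bottomSpectrum_lt_one hz hdeg
  set t := G.bottomSpectrum Set.univ with ht
  have hq0 : 0 < (1 - t) / (1 - -α) := div_pos (by linarith) (by linarith)
  have hq1 : (1 - t) / (1 - -α) ≤ 1 := by rw [div_le_one (by linarith)]; linarith
  have hcosh := mul_cosh_log_inv_add_log_sqrt hq0 hq1
  rw [← G.decayExponent_combDist] at hcosh
  have ha0 : 0 ≤ G.decayExponent G.combDist (-α) t := by
    rw [G.decayExponent_combDist]
    refine add_nonneg (Real.log_nonneg ((one_le_inv₀ hq0).2 hq1)) (Real.log_nonneg ?_)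
    linarith [Real.sqrt_nonneg (1 - ((1 - t) / (1 - -α)) ^ 2)]
  set a := G.decayExponent G.combDist (-α) t with ha
  have hcosh' : (1 - t) * Real.cosh a = 1 + α := by
    have : 1 - -α ≠ 0 := by linarith
    field_simp at hcosh
    linarith
  refine G.exists_resolventSqSum_le (κ := fun x y => 2 * (Real.cosh a - 1)) hρ (by linarith) ha0
    zero_le_one (fun x y h => (G.combDist_of_adj h).le) (fun x y hxy δ hδ => ?_)
    (fun S v hv => ?_) x₀
  · rw [G.combDist_of_adj hxy] at hδ
    -- This suffices because (e^{aδ} − 1)² = 2(cosh(aδ) − 1)e^{aδ}.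
    have h2 : Real.cosh (a * δ) ≤ Real.cosh a := by
      rw [Real.cosh_le_cosh, abs_mul]
      exact mul_le_of_le_one_right (abs_nonneg a) hδ
    have he : Real.exp (a * δ) * Real.exp (-(a * δ)) = 1 := by
      rw [← Real.exp_add, add_neg_cancel, Real.exp_zero]
    rw [Real.cosh_eq] at h2
    have := mul_le_mul_of_nonneg_left h2 (Real.exp_pos (a * δ)).le
    nlinarith
  · have h2 := G.sum_sum_mul_le_one_sub hdeg S v
    have h3 : ∑ x ∈ S, ∑ y ∈ S, G.w x y * (2 * (Real.cosh a - 1) * (v x * v y)) =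
        2 * (Real.cosh a - 1) * ∑ x ∈ S, ∑ y ∈ S, G.w x y * (v x * v y) := by
      simp only [Finset.mul_sum]
      exact Finset.sum_congr rfl fun x _ => Finset.sum_congr rfl fun y _ => by ring
    rw [h3]
    have h4 := mul_le_mul_of_nonneg_left h2 (sub_nonneg.2 (Real.one_le_cosh a))
    have h5 : (Real.cosh a - 1) * ((1 - t) * ∑ x ∈ S, v x ^ 2 * G.m x) =
        (t + α) * ∑ x ∈ S, v x ^ 2 * G.m x := by
      rw [← mul_assoc]; congr 1; linarith
    linarith

/-! ### Combinatorial distance, supersolutions and spheres -/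

theorem exists_adj_dist_eq {x o : V} {k : ℕ} (h : G.graph.dist x o = k + 1) :
    ∃ y, G.graph.Adj x y ∧ G.graph.dist y o = k := by
  obtain ⟨p, hp⟩ := G.connected.exists_walk_length_eq_dist x o
  cases p with
  | nil => simp at h
  | cons hxy q =>
    rename_i y
    refine ⟨y, hxy, le_antisymm ?_ ?_⟩
    · have := G.graph.dist_le q
      simp at hp; omega
    · have h1 := G.connected.dist_triangle (u := x) (v := y) (w := o)
      have h2 := SimpleGraph.dist_eq_one_iff_adj.2 hxy
      omega

theorem finite_setOf_dist_le (o : V) (n : ℕ) : {y | G.graph.dist y o ≤ n}.Finite := by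
  induction n with
  | zero =>
    refine (Set.finite_singleton o).subset fun y hy => ?_
    exact G.connected.dist_eq_zero_iff.1 (Nat.le_zero.1 hy)
  | succ n ih =>
    refine (ih.union (ih.biUnion fun z _ => G.locallyFinite z)).subset fun y hy => ?_
    rcases Nat.lt_or_ge n (G.graph.dist y o) with h | h
    · have hy' : G.graph.dist y o ≤ n + 1 := hy
      obtain ⟨z, hz, hzo⟩ := G.exists_adj_dist_eq (show G.graph.dist y o = n + 1 by omega)
      exact Or.inr (Set.mem_biUnion (x := z) hzo.le hz.symm)
    · exact Or.inl h

theorem isAdmissibleMetric_combDist (h : ∀ x, G.deg x ≤ G.m x) :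
    G.IsAdmissibleMetric G.combDist where
  nonneg x y := Nat.cast_nonneg _
  self x := by simp [combDist]
  symm x y := by rw [combDist, combDist, SimpleGraph.dist_comm]
  triangle x y z := by
    simp only [combDist]
    exact_mod_cast G.connected.dist_triangle
  intrinsic x := by
    refine le_trans (le_of_eq ?_) (h x)
    refine Finset.sum_congr rfl fun y hy => ?_
    rw [G.combDist_of_adj (G.mem_nbrs.1 hy)]; ring
  finite_ball x R _ := by
    obtain ⟨n, hn⟩ := exists_nat_ge R
    refine (G.finite_setOf_dist_le x n).subset fun y hy => ?_
    have : (G.graph.dist y x : ℝ) ≤ n := le_trans hy hn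
    exact_mod_cast this
  bddAbove_jump := by
    refine ⟨1, ?_⟩
    rintro r ⟨x, y, hxy, rfl⟩
    exact (G.combDist_of_adj hxy).le

theorem jumpSize_combDist [Nontrivial V] : G.jumpSize G.combDist = 1 := by
  obtain ⟨x⟩ := (inferInstance : Nonempty V)
  obtain ⟨y, hy⟩ := G.connected.preconnected.exists_adj_of_nontrivial x
  have : {r : ℝ | ∃ x y, G.graph.Adj x y ∧ r = G.combDist x y} = {1} := by
    ext r
    constructor
    · rintro ⟨x, y, hxy, rfl⟩
      exact G.combDist_of_adj hxy
    · rintro rfl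
      exact ⟨x, y, hy, (G.combDist_of_adj hy).symm⟩
  rw [jumpSize, this, csSup_singleton]

theorem laplacian_mono {f g : V → ℝ} {x : V} (h : ∀ y, f y ≤ g y) (hx : f x = g x) :
    G.laplacian f x ≤ G.laplacian g x := by
  refine Finset.sum_le_sum fun y _ => ?_
  rw [hx]
  exact mul_le_mul_of_nonneg_left (by linarith [h y])
    (div_nonneg (G.w_nonneg x y) (G.m_pos x).le)

/-- A positive supersolution bounds the bottom of the spectrum from below. -/
theorem le_bottomSpectrum [Nonempty V] {h : V → ℝ} (hpos : ∀ x, 0 < h x) {l : ℝ}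
    (hl : ∀ x, G.laplacian h x ≤ -l * h x) : l ≤ G.bottomSpectrum Set.univ := by
  classical
  have key : ∀ f : V → ℝ, f.support.Finite → l * G.normSq f ≤ G.energy f := by
    intro f hf
    set S := hf.toFinset
    have hf0 : ∀ x ∉ S, f x = 0 := fun x hx => by simpa [S] using hx
    rw [G.normSq_eq hf0, G.energy_eq hf0]
    have hsymm : ∑ x ∈ S, ∑ y ∈ S, G.w x y * (f y ^ 2 * (h x / h y)) =
        ∑ x ∈ S, ∑ y ∈ S, G.w x y * (f x ^ 2 * (h y / h x)) := by
      rw [Finset.sum_comm]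
      exact Finset.sum_congr rfl fun x _ => Finset.sum_congr rfl fun y _ => by rw [G.w_symm]
    have h1 : ∑ x ∈ S, ∑ y ∈ S, G.w x y * (f x * f y) ≤
        ∑ x ∈ S, ∑ y ∈ S, (1 / 2 * (G.w x y * (f x ^ 2 * (h y / h x))) +
          1 / 2 * (G.w x y * (f y ^ 2 * (h x / h y)))) := by
      refine Finset.sum_le_sum fun x _ => Finset.sum_le_sum fun y _ => ?_
      have hx := hpos x
      have hy := hpos y
      -- Weighted AM–GM with the supersolution as weight; afterwards h enters only through ∑ w h,
      -- which the hypothesis on Δh controls.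
      have : 0 ≤ f x ^ 2 * (h y / h x) + f y ^ 2 * (h x / h y) - 2 * (f x * f y) := by
        have e : f x ^ 2 * (h y / h x) + f y ^ 2 * (h x / h y) - 2 * (f x * f y) =
            (f x * h y - f y * h x) ^ 2 / (h x * h y) := by
          field_simp; ring
        rw [e]; positivity
      nlinarith [mul_nonneg (G.w_nonneg x y) this]
    have h2 : ∑ x ∈ S, ∑ y ∈ S, G.w x y * (f x ^ 2 * (h y / h x)) ≤
        ∑ x ∈ S, (G.deg x * f x ^ 2 - l * (f x ^ 2 * G.m x)) := by
      refine Finset.sum_le_sum fun x _ => ?_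
      have hx := hpos x
      have hm := G.m_pos x
      have e1 : ∑ y ∈ S, G.w x y * h y ≤ ∑ y ∈ G.nbrs x, G.w x y * h y := by
        have h0 : ∑ y ∈ G.nbrs x, G.w x y * (if y ∈ S then h y else 0) =
            ∑ y ∈ S, G.w x y * h y := by
          rw [G.sum_nbrs_eq x (S := S) fun y hy => if_neg hy]
          exact Finset.sum_congr rfl fun y hy => by rw [if_pos hy]
        rw [← h0]
        refine Finset.sum_le_sum fun y _ => mul_le_mul_of_nonneg_left ?_ (G.w_nonneg x y)
        split_ifs
        · exact le_rfl
        · exact (hpos y).le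
      have e2 := mul_le_mul_of_nonneg_left (hl x) hm.le
      rw [G.mul_laplacian] at e2
      have e3 : ∑ y ∈ S, G.w x y * (f x ^ 2 * (h y / h x)) =
          f x ^ 2 / h x * ∑ y ∈ S, G.w x y * h y := by
        rw [Finset.mul_sum]
        exact Finset.sum_congr rfl fun y _ => by field_simp
      rw [e3]
      calc f x ^ 2 / h x * ∑ y ∈ S, G.w x y * h y
          ≤ f x ^ 2 / h x * ((G.deg x - l * G.m x) * h x) :=
            mul_le_mul_of_nonneg_left (by linarith) (by positivity)
        _ = _ := by field_simp
    simp only [Finset.sum_add_distrib, ← Finset.mul_sum] at h1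
    rw [hsymm] at h1
    rw [Finset.sum_sub_distrib, ← Finset.mul_sum] at h2
    linarith
  obtain ⟨x⟩ := (inferInstance : Nonempty V)
  refine le_csInf ⟨_, Pi.single x 1, ?_, Set.subset_univ _, ?_, rfl⟩ ?_
  · exact (Set.finite_singleton x).subset fun y hy => by
      by_contra h
      exact hy (Pi.single_eq_of_ne h _)
  · intro h
    have := congrFun h x
    simp at this
  · rintro q ⟨f, hf, -, h0, rfl⟩
    rw [le_div_iff₀ (G.normSq_pos hf h0)]
    exact key f hf

/-- The finite set of vertices at combinatorial distance `k` from `o`. -/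
noncomputable def sphere (o : V) (k : ℕ) : Finset V :=
  ((G.finite_setOf_dist_le o k).subset
    (fun _ hy => le_of_eq hy : {y | G.graph.dist y o = k} ⊆ _)).toFinset

theorem mem_sphere {o x : V} {k : ℕ} : x ∈ G.sphere o k ↔ G.graph.dist x o = k := by
  simp [sphere]

open Classical in
/-- The vertices whose combinatorial distance from `o` lies in `I`. -/
noncomputable def shell (o : V) (I : Finset ℕ) : Finset V := I.biUnion (G.sphere o)

theorem mem_shell {o x : V} {I : Finset ℕ} : x ∈ G.shell o I ↔ G.graph.dist x o ∈ I := by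
  simp [shell, mem_sphere]

theorem sum_shell (o : V) (I : Finset ℕ) (f : ℕ → ℝ) :
    ∑ x ∈ G.shell o I, f (G.graph.dist x o) = ∑ k ∈ I, ((G.sphere o k).card : ℝ) * f k := by
  classical
  rw [shell, Finset.sum_biUnion]
  · refine Finset.sum_congr rfl fun k _ => ?_
    rw [← nsmul_eq_mul, ← Finset.sum_const]
    exact Finset.sum_congr rfl fun x hx => by rw [G.mem_sphere.1 hx]
  · intro k _ l _ hkl
    refine Finset.disjoint_left.2 fun x hx hx' => hkl ?_
    rw [← G.mem_sphere.1 hx, ← G.mem_sphere.1 hx']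

theorem sphere_zero (o : V) : G.sphere o 0 = {o} := by
  ext x
  rw [mem_sphere, Finset.mem_singleton, G.connected.dist_eq_zero_iff]

/-! ### Regular trees: sphere sizes and the bottom of the spectrum -/

namespace IsRegularTree

variable {G} {N : ℕ} (hT : G.IsRegularTree N)

include hT

theorem sum_w_mul (x : V) (f : V → ℝ) :
    ∑ y ∈ G.nbrs x, G.w x y * f y = ∑ y ∈ G.nbrs x, f y :=
  Finset.sum_congr rfl fun y hy => by rw [hT.w_eq_one x y (G.mem_nbrs.1 hy), one_mul]

theorem deg_eq (x : V) : G.deg x = N := by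
  have := hT.sum_w_mul x fun _ => 1
  simpa [deg, hT.regular x] using this

theorem isAdmissibleMetric : G.IsAdmissibleMetric G.combDist :=
  G.isAdmissibleMetric_combDist fun x => by rw [hT.deg_eq, hT.m_eq]

/-- A vertex at distance `k + 1` from the root has exactly one neighbour at distance `k`. -/
theorem exists_parent {x o : V} {k : ℕ} (h : G.graph.dist x o = k + 1) :
    ∃ y ∈ G.nbrs x, G.graph.dist y o = k ∧
      ∀ z ∈ G.nbrs x, z ≠ y → G.graph.dist z o = k + 2 := by
  obtain ⟨y, hxy, hy⟩ := G.exists_adj_dist_eq h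
  refine ⟨y, G.mem_nbrs.2 hxy, hy, fun z hz hne => ?_⟩
  have hxz := G.mem_nbrs.1 hz
  by_contra hzk
  have hz' : G.graph.dist z o = k := by
    have := hT.isTree.dist_eq_dist_add_one_of_adj o hxz
    rw [SimpleGraph.dist_comm (u := o), SimpleGraph.dist_comm (u := o)] at this
    omega
  -- Two neighbours at distance k would extend to two different geodesic paths from x to o,
  -- contradicting uniqueness of paths in a tree.
  obtain ⟨p, hp⟩ := G.connected.exists_walk_length_eq_dist y o
  obtain ⟨q, hq⟩ := G.connected.exists_walk_length_eq_dist z o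
  have hp' : (SimpleGraph.Walk.cons hxy p).IsPath :=
    SimpleGraph.Walk.isPath_of_length_eq_dist _ (by simp; omega)
  have hq' : (SimpleGraph.Walk.cons hxz q).IsPath :=
    SimpleGraph.Walk.isPath_of_length_eq_dist _ (by simp; omega)
  have := (hT.isTree.existsUnique_path x o).unique hp' hq'
  simp only [SimpleGraph.Walk.cons.injEq] at this
  exact hne this.1.symm

theorem sum_nbrs_of_dist_succ {x o : V} {k : ℕ} (h : G.graph.dist x o = k + 1) (f : ℕ → ℝ) :
    ∑ y ∈ G.nbrs x, f (G.graph.dist y o) = f k + ((N : ℝ) - 1) * f (k + 2) := by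
  classical
  obtain ⟨y, hy, hyk, hz⟩ := hT.exists_parent h
  rw [← Finset.add_sum_erase _ _ hy, hyk]
  have hN : 1 ≤ N := by rw [← hT.regular x]; exact Finset.card_pos.2 ⟨y, hy⟩
  rw [Finset.sum_congr rfl fun z hz' => by
    rw [hz z (Finset.mem_of_mem_erase hz') (Finset.ne_of_mem_erase hz')], Finset.sum_const,
    Finset.card_erase_of_mem hy, hT.regular, nsmul_eq_mul, Nat.cast_sub hN, Nat.cast_one]

theorem sum_nbrs_root (o : V) (f : ℕ → ℝ) :
    ∑ y ∈ G.nbrs o, f (G.graph.dist y o) = N * f 1 := by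
  rw [Finset.sum_congr rfl fun z hz => by
    rw [SimpleGraph.dist_eq_one_iff_adj.2 (G.mem_nbrs.1 hz).symm], Finset.sum_const, hT.regular,
    nsmul_eq_mul]

/-- Count the edges between consecutive spheres twice: each outer vertex has one parent, each inner
vertex has c children. -/
theorem sum_nbrs_sphere (o : V) (k : ℕ) {c : ℝ}
    (hc : ∀ x ∈ G.sphere o k, ∑ y ∈ G.nbrs x, (if G.graph.dist y o = k + 1 then (1 : ℝ) else 0) = c) :
    ((G.sphere o (k + 1)).card : ℝ) = c * (G.sphere o k).card := by
  have h1 : ∀ x ∈ G.sphere o k, ∑ y ∈ G.sphere o (k + 1), G.w x y = c := by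
    intro x hx
    rw [← hc x hx, ← hT.sum_w_mul, G.sum_nbrs_eq x (S := G.sphere o (k + 1))
      fun y hy => if_neg fun h => hy (G.mem_sphere.2 h)]
    exact Finset.sum_congr rfl fun y hy => by rw [if_pos (G.mem_sphere.1 hy), mul_one]
  have h2 : ∀ y ∈ G.sphere o (k + 1), ∑ x ∈ G.sphere o k, G.w x y = 1 := by
    intro y hy
    have := hT.sum_nbrs_of_dist_succ (G.mem_sphere.1 hy) fun l => if l = k then 1 else 0
    rw [← hT.sum_w_mul, G.sum_nbrs_eq y (S := G.sphere o k)
      fun y hy => if_neg fun h => hy (G.mem_sphere.2 h)] at this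
    simp only [if_true, Nat.add_eq_left, OfNat.ofNat_ne_zero, if_false, mul_zero, add_zero] at this
    rw [← this]
    exact Finset.sum_congr rfl fun x hx => by rw [if_pos (G.mem_sphere.1 hx), mul_one, G.w_symm]
  have h3 := Finset.sum_comm (s := G.sphere o k) (t := G.sphere o (k + 1)) (f := G.w)
  rw [Finset.sum_congr rfl h1, Finset.sum_congr rfl h2] at h3
  simpa [mul_comm] using h3.symm

theorem card_sphere_succ (o : V) (k : ℕ) :
    ((G.sphere o (k + 1)).card : ℝ) = N * ((N : ℝ) - 1) ^ k := by
  induction k with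
  | zero =>
    rw [hT.sum_nbrs_sphere o 0 (c := N) fun x hx => ?_, sphere_zero]
    · simp
    · rw [sphere_zero, Finset.mem_singleton] at hx
      subst hx
      rw [hT.sum_nbrs_root x fun l => if l = 0 + 1 then 1 else 0]
      simp
  | succ k ih =>
    rw [hT.sum_nbrs_sphere o (k + 1) (c := N - 1) fun x hx => ?_, ih]
    · ring
    · rw [hT.sum_nbrs_of_dist_succ (G.mem_sphere.1 hx) fun l => if l = k + 1 + 1 then 1 else 0]
      simp
      omega

theorem infinite (hN : 3 ≤ N) : Infinite V := by
  have hN' : (3 : ℝ) ≤ N := by exact_mod_cast hN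
  obtain ⟨o⟩ := G.connected.nonempty
  have hne : ∀ k, (G.sphere o (k + 1)).Nonempty := fun k => by
    rw [← Finset.card_pos]
    have := hT.card_sphere_succ o k
    have h2 : (0 : ℝ) < N * ((N : ℝ) - 1) ^ k := by
      have : (0 : ℝ) < N - 1 := by linarith
      positivity
    rw [← this] at h2
    exact_mod_cast h2
  choose f hf using hne
  refine Infinite.of_injective f fun k l hkl => ?_
  have h1 := G.mem_sphere.1 (hf k)
  have h2 := G.mem_sphere.1 (hf l)
  rw [hkl, h2] at h1
  omega

theorem laplacian_root (o : V) (f : ℕ → ℝ) (hN : N ≠ 0) :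
    G.laplacian (fun y => f (G.graph.dist y o)) o = f 1 - f 0 := by
  have h := G.mul_laplacian (fun y => f (G.graph.dist y o)) o
  have hN' : (N : ℝ) ≠ 0 := Nat.cast_ne_zero.2 hN
  rw [hT.sum_w_mul, hT.sum_nbrs_root, hT.deg_eq, hT.m_eq, SimpleGraph.dist_self, ← mul_sub] at h
  exact mul_left_cancel₀ hN' h

theorem laplacian_of_dist_succ {x o : V} {k : ℕ} (h : G.graph.dist x o = k + 1) (f : ℕ → ℝ) :
    N * G.laplacian (fun y => f (G.graph.dist y o)) x =
      f k + ((N : ℝ) - 1) * f (k + 2) - N * f (k + 1) := by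
  have h1 := G.mul_laplacian (fun y => f (G.graph.dist y o)) x
  rwa [hT.sum_w_mul, hT.sum_nbrs_of_dist_succ h, hT.deg_eq, hT.m_eq, h] at h1

/-- The function `(N-1)^{-|x|/2}` is a positive supersolution at the bottom of the spectrum. -/
theorem laplacian_sqrt_pow_le (hN : 3 ≤ N) (o x : V) :
    G.laplacian (fun y => (Real.sqrt ((N : ℝ) - 1))⁻¹ ^ G.graph.dist y o) x ≤
      -(1 - 2 * Real.sqrt ((N : ℝ) - 1) / N) *
        (Real.sqrt ((N : ℝ) - 1))⁻¹ ^ G.graph.dist x o := by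
  have hN' : (3 : ℝ) ≤ N := by exact_mod_cast hN
  have hN0 : (0 : ℝ) < N := by linarith
  have hθ : 0 < Real.sqrt ((N : ℝ) - 1) := Real.sqrt_pos.2 (by linarith)
  have hθ2 := Real.sq_sqrt (show 0 ≤ (N : ℝ) - 1 by linarith)
  set θ := Real.sqrt ((N : ℝ) - 1) with hθ'
  rcases hk : G.graph.dist x o with _ | k
  · have hxo := G.connected.dist_eq_zero_iff.1 hk
    subst hxo
    rw [hT.laplacian_root x (fun k => θ⁻¹ ^ k) (by omega)]
    -- At the root the supersolution inequality amounts to N ≤ 2(N − 1); on all other spheres it is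
    -- an equality.
    have : θ⁻¹ ≤ 2 * θ / N := by
      rw [le_div_iff₀ hN0, inv_mul_le_iff₀ hθ]
      nlinarith
    simp only [pow_one, pow_zero]
    linarith
  · rw [← mul_le_mul_iff_right₀ hN0, hT.laplacian_of_dist_succ hk fun k => θ⁻¹ ^ k]
    apply le_of_eq
    have h1 : θ * θ⁻¹ = 1 := mul_inv_cancel₀ hθ.ne'
    have h2 : N * (-(1 - 2 * θ / N) * θ⁻¹ ^ (k + 1)) = (2 * θ - N) * θ⁻¹ ^ (k + 1) := by
      field_simp; ring
    rw [h2, ← hθ2]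
    linear_combination (θ⁻¹ ^ k * (θ * θ⁻¹ - 1)) * h1

/-- Rayleigh quotient estimate for the truncation of `(N-1)^{-|x|/2}` at level `M + 1`. -/
theorem bottomSpectrum_sub_mul_le (hN : 3 ≤ N) (o : V) (M : ℕ) :
    (G.bottomSpectrum Set.univ - (1 - 2 * Real.sqrt ((N : ℝ) - 1) / N)) *
      (N * (1 + (M + 1) * (N / ((N : ℝ) - 1)))) ≤
      2 * Real.sqrt ((N : ℝ) - 1) + Real.sqrt ((N : ℝ) - 1) * (N / ((N : ℝ) - 1)) := by
  have hN' : (3 : ℝ) ≤ N := by exact_mod_cast hN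
  have hN0 : (0 : ℝ) < N := by linarith
  have hN1 : (0 : ℝ) < (N : ℝ) - 1 := by linarith
  have hθ : 0 < Real.sqrt ((N : ℝ) - 1) := Real.sqrt_pos.2 (by linarith)
  have hθ2 := Real.sq_sqrt hN1.le
  set θ := Real.sqrt ((N : ℝ) - 1) with hθ'
  set l := 1 - 2 * θ / N with hl
  have hlN : l * N = N - 2 * θ := by rw [hl]; field_simp
  set φ := θ⁻¹ with hφ
  have hφ0 : 0 < φ := inv_pos.2 hθ
  have hθφ : θ * φ = 1 := mul_inv_cancel₀ hθ.ne'
  set f : ℕ → ℝ := fun k => if k ≤ M + 1 then φ ^ k else 0 with hf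
  -- Upper bound for the defect in the eigenvalue equation, present only at the root and on the
  -- outermost sphere, whose children are cut off.
  set E : ℕ → ℝ := fun k => (if k = 0 then 2 * θ else 0) +
    (if k = M + 1 then θ * (φ ^ k) ^ 2 else 0) with hE
  set S := G.shell o (Finset.range (M + 2)) with hS
  have hfS : ∀ x ∉ S, f (G.graph.dist x o) = 0 := by
    intro x hx
    rw [hS, mem_shell, Finset.mem_range] at hx
    exact if_neg (by omega)
  -- Every sphere but the root carries the same mass, so the norm grows linearly in M while the
  -- total defect stays bounded.
  have hcard : ∀ k, ((G.sphere o (k + 1)).card : ℝ) * (φ ^ (k + 1)) ^ 2 = N / ((N : ℝ) - 1) := by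
    intro k
    have h1 : ((N : ℝ) - 1) * φ ^ 2 = 1 := by
      rw [← hθ2, ← mul_pow, hθφ, one_pow]
    rw [hT.card_sphere_succ, eq_div_iff hN1.ne', ← pow_mul, mul_comm (k + 1) 2, pow_mul]
    calc (N : ℝ) * ((N : ℝ) - 1) ^ k * (φ ^ 2) ^ (k + 1) * ((N : ℝ) - 1)
        = (N : ℝ) * (((N : ℝ) - 1) * φ ^ 2) ^ (k + 1) := by rw [mul_pow]; ring
      _ = (N : ℝ) := by rw [h1, one_pow, mul_one]
  have hnorm : ∑ x ∈ S, f (G.graph.dist x o) ^ 2 * G.m x =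
      N * (1 + (M + 1) * (N / ((N : ℝ) - 1))) := by
    simp only [hT.m_eq]
    rw [hS, G.sum_shell o _ fun k => f k ^ 2 * N, Finset.sum_range_succ']
    have h2 : ∀ k ∈ Finset.range (M + 1),
        ((G.sphere o (k + 1)).card : ℝ) * (f (k + 1) ^ 2 * N) = N / ((N : ℝ) - 1) * N := by
      intro k hk
      rw [Finset.mem_range] at hk
      rw [← hcard k]
      simp only [hf]
      rw [if_pos (by omega)]; ring
    rw [Finset.sum_congr rfl h2, Finset.sum_const, Finset.card_range, nsmul_eq_mul, sphere_zero]
    simp [hf]; ring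
  have hterm : ∀ x ∈ S, G.deg x * f (G.graph.dist x o) ^ 2 -
      ∑ y ∈ S, G.w x y * (f (G.graph.dist x o) * f (G.graph.dist y o)) ≤
      l * (f (G.graph.dist x o) ^ 2 * G.m x) + E (G.graph.dist x o) := by
    intro x hx
    rw [← G.sum_nbrs_eq x (f := fun y => f (G.graph.dist x o) * f (G.graph.dist y o))
      (fun y hy => by simp [hfS y hy]), hT.sum_w_mul, ← Finset.mul_sum, hT.deg_eq, hT.m_eq]
    rw [hS, mem_shell, Finset.mem_range] at hx
    rcases hk : G.graph.dist x o with _ | k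
    · have hxo := G.connected.dist_eq_zero_iff.1 hk
      subst hxo
      rw [hT.sum_nbrs_root]
      have h0 : f 0 = 1 := by simp [hf]
      have h1 : f 1 = φ := by simp [hf]
      have hE0 : 2 * θ ≤ E 0 := by simp [hE]
      rw [h0, h1]
      nlinarith [mul_pos hN0 hφ0]
    · rw [hT.sum_nbrs_of_dist_succ hk]
      rw [hk] at hx
      have h0 : f k = φ ^ k := if_pos (by omega)
      have h1 : f (k + 1) = φ ^ (k + 1) := if_pos (by omega)
      rw [h0, h1]
      by_cases hkM : k + 2 ≤ M + 1
      · have h2 : f (k + 2) = φ ^ (k + 2) := if_pos hkM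
        have hE0 : E (k + 1) = 0 := by
          simp only [hE]
          rw [if_neg (by omega), if_neg (by omega), add_zero]
        rw [h2, hE0, ← hθ2]
        apply le_of_eq
        linear_combination (-(φ ^ k) * φ ^ (k + 1) * (θ * φ - 1)) * hθφ -
          (φ ^ (k + 1)) ^ 2 * hlN
      · have h2 : f (k + 2) = 0 := if_neg hkM
        have hE0 : E (k + 1) = θ * (φ ^ (k + 1)) ^ 2 := by
          simp only [hE]
          rw [if_neg (by omega), if_pos (by omega), zero_add]
        rw [h2, hE0]
        apply le_of_eq
        linear_combination (φ ^ k * φ ^ (k + 1)) * hθφ - (φ ^ (k + 1)) ^ 2 * hlN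
  have hEsum : ∑ x ∈ S, E (G.graph.dist x o) = 2 * θ + θ * (N / ((N : ℝ) - 1)) := by
    rw [hS, G.sum_shell]
    simp only [hE, mul_add, Finset.sum_add_distrib, mul_ite, mul_zero, Finset.sum_ite_eq',
      Finset.mem_range]
    rw [if_pos (by omega), if_pos (by omega), sphere_zero, ← hcard M]
    simp; ring
  have hB := G.bottomSpectrum_mul_sum_le hfS
  rw [← Finset.sum_sub_distrib] at hB
  have h3 := hB.trans (Finset.sum_le_sum hterm)
  rw [Finset.sum_add_distrib, ← Finset.mul_sum, hnorm, hEsum] at h3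
  linarith

theorem bottomSpectrum_eq (hN : 3 ≤ N) :
    G.bottomSpectrum Set.univ = 1 - 2 * Real.sqrt ((N : ℝ) - 1) / N := by
  have hN' : (3 : ℝ) ≤ N := by exact_mod_cast hN
  have hθ : 0 < Real.sqrt ((N : ℝ) - 1) := Real.sqrt_pos.2 (by linarith)
  obtain ⟨o⟩ := G.connected.nonempty
  have : Nonempty V := ⟨o⟩
  apply le_antisymm
  · by_contra hcon
    push Not at hcon
    set K := 2 * Real.sqrt ((N : ℝ) - 1) + Real.sqrt ((N : ℝ) - 1) * (N / ((N : ℝ) - 1))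
    set d := G.bottomSpectrum Set.univ - (1 - 2 * Real.sqrt ((N : ℝ) - 1) / N)
    have hd : 0 < d := sub_pos.2 hcon
    obtain ⟨M, hM⟩ := exists_nat_gt (K / d)
    rw [div_lt_iff₀ hd] at hM
    have h := hT.bottomSpectrum_sub_mul_le hN o M
    have hr : 1 ≤ N / ((N : ℝ) - 1) := by rw [one_le_div (by linarith)]; linarith
    have h1 : (M : ℝ) ≤ N * (1 + (M + 1) * (N / ((N : ℝ) - 1))) := by
      have hM0 : (0 : ℝ) ≤ M := M.cast_nonneg
      have h2 : (M : ℝ) ≤ 1 + (M + 1) * (N / ((N : ℝ) - 1)) := by nlinarith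
      exact h2.trans (le_mul_of_one_le_left (hM0.trans h2) (by linarith))
    have := mul_le_mul_of_nonneg_left h1 hd.le
    linarith
  · exact G.le_bottomSpectrum (fun x => pow_pos (inv_pos.2 hθ) _)
      (hT.laplacian_sqrt_pow_le hN o)

end IsRegularTree

end WeightedGraph

theorem sqrt_sub_one_div_lt {N : ℕ} (hN : 3 ≤ N) :
    0 < 1 - 2 * Real.sqrt ((N : ℝ) - 1) / N := by
  have hN' : (3 : ℝ) ≤ N := by exact_mod_cast hN
  have : Real.sqrt ((N : ℝ) - 1) < N / 2 := by
    rw [Real.sqrt_lt' (by linarith)]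
    nlinarith
  rw [sub_pos, div_lt_one (by linarith)]
  linarith

/-! ### Algebra of the root b -/

section TreeRoot

variable {N : ℕ} (hN : 3 ≤ N) {α : ℝ} (hα : 0 ≤ α)

include hN hα

/-- Equality holds at α = 0, where b = N − 1; the discriminant increases with α. -/
theorem treeRoot_discr_nonneg : (N - 2 : ℝ) ^ 2 ≤ (α + 1) ^ 2 * (N : ℝ) ^ 2 - 4 * N + 4 := by
  have hN' : (3 : ℝ) ≤ N := by exact_mod_cast hN
  have h1 : (1 : ℝ) ≤ (α + 1) ^ 2 := one_le_pow₀ (by linarith)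
  nlinarith [mul_le_mul_of_nonneg_right h1 (sq_nonneg (N : ℝ))]

theorem sub_one_le_treeRoot : (N : ℝ) - 1 ≤ treeRoot N α := by
  have hN' : (3 : ℝ) ≤ N := by exact_mod_cast hN
  have h1 := Real.le_sqrt_of_sq_le (treeRoot_discr_nonneg hN hα)
  have h2 : (N : ℝ) ≤ (α + 1) * N := le_mul_of_one_le_left (by linarith) (by linarith)
  rw [treeRoot]
  linarith

theorem treeRoot_equation : treeRoot N α ^ 2 + ((N : ℝ) - 1) = (α + 1) * N * treeRoot N α := by
  have h := Real.sq_sqrt ((sq_nonneg _).trans (treeRoot_discr_nonneg hN hα))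
  rw [treeRoot]
  linear_combination (1 / 4 : ℝ) * h

theorem one_lt_treeRoot : 1 < treeRoot N α := by
  have hN' : (3 : ℝ) ≤ N := by exact_mod_cast hN
  have := sub_one_le_treeRoot hN hα
  linarith

theorem sqrt_le_treeRoot : Real.sqrt ((N : ℝ) - 1) ≤ treeRoot N α := by
  have hN' : (3 : ℝ) ≤ N := by exact_mod_cast hN
  refine le_trans ?_ (sub_one_le_treeRoot hN hα)
  rw [Real.sqrt_le_left (by linarith)]
  nlinarith

theorem treeConst_pos : 0 < 1 / (N * (α + 1 - 1 / treeRoot N α)) := by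
  have hN' : (3 : ℝ) ≤ N := by exact_mod_cast hN
  have h1 := one_lt_treeRoot hN hα
  have : 1 / treeRoot N α < 1 := by rw [div_lt_one (by linarith)]; exact h1
  have h2 : 0 < α + 1 - 1 / treeRoot N α := by linarith
  positivity

/-- For q = 2θ/(N(1 + α)) the quantity (1 + √(1 − q²))/q equals b/θ, hence e^{-2a} = (N − 1)/b². -/
theorem exp_neg_mul_decay (n : ℕ) :
    (((N : ℝ) - 1) / treeRoot N α ^ 2) ^ n = Real.exp (-2 *
      (Real.log ((2 * Real.sqrt ((N : ℝ) - 1) / N) / (1 + α))⁻¹ + Real.log (1 + Real.sqrt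
        (1 - ((2 * Real.sqrt ((N : ℝ) - 1) / N) / (1 + α)) ^ 2))) * n) := by
  have hN' : (3 : ℝ) ≤ N := by exact_mod_cast hN
  have hN0 : (0 : ℝ) < N := by linarith
  have hα1 : 0 < 1 + α := by linarith
  have hθ : 0 < Real.sqrt ((N : ℝ) - 1) := Real.sqrt_pos.2 (by linarith)
  have hθ2 := Real.sq_sqrt (show 0 ≤ (N : ℝ) - 1 by linarith)
  set θ := Real.sqrt ((N : ℝ) - 1)
  set q := (2 * θ / N) / (1 + α) with hq
  have hq0 : 0 < q := by positivity
  have hsq : Real.sqrt (1 - q ^ 2) =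
      Real.sqrt ((α + 1) ^ 2 * (N : ℝ) ^ 2 - 4 * N + 4) / ((1 + α) * N) := by
    have hD := (sq_nonneg _).trans (treeRoot_discr_nonneg hN hα)
    have e : 1 - q ^ 2 = ((α + 1) ^ 2 * (N : ℝ) ^ 2 - 4 * N + 4) / ((1 + α) * N) ^ 2 := by
      rw [hq, div_pow, div_pow, mul_pow, hθ2]
      field_simp
      ring
    rw [e, Real.sqrt_div hD, Real.sqrt_sq (by positivity)]
  have hexp := WeightedGraph.exp_log_inv_add_log_sqrt hq0
  set a := Real.log q⁻¹ + Real.log (1 + Real.sqrt (1 - q ^ 2)) with ha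
  have hb : Real.exp a = treeRoot N α / θ := by
    rw [hexp, hsq, hq, treeRoot]
    field_simp
    ring
  have h1 : Real.exp (-2 * a * n) = ((Real.exp a ^ 2)⁻¹) ^ n := by
    rw [← Real.exp_nat_mul, ← Real.exp_neg, ← Real.exp_nat_mul]
    congr 1; push_cast; ring
  rw [h1, hb, ← hθ2, ← div_pow, ← inv_pow, inv_div]

end TreeRoot

namespace WeightedGraph

variable {V : Type*} {G : WeightedGraph V}

/-! ### The Green function of the tree -/

namespace IsRegularTree

open Filter Topology

variable {N : ℕ} (hT : G.IsRegularTree N)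

include hT

/-- The explicit Green function of the tree solves the resolvent equation. -/
theorem green_equation [DecidableEq V] (hN : 3 ≤ N) {α : ℝ} (hα : 0 ≤ α) (z y : V) :
    α * (1 / (N * (α + 1 - 1 / treeRoot N α)) * (treeRoot N α)⁻¹ ^ G.graph.dist y z) -
      G.laplacian (fun y => 1 / (N * (α + 1 - 1 / treeRoot N α)) *
        (treeRoot N α)⁻¹ ^ G.graph.dist y z) y = if y = z then 1 / G.m z else 0 := by
  have hN' : (3 : ℝ) ≤ N := by exact_mod_cast hN
  have hN0 : (0 : ℝ) < N := by linarith
  have hb1 := one_lt_treeRoot hN hα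
  have hbe := treeRoot_equation hN hα
  have hc := treeConst_pos hN hα
  set c := 1 / (N * (α + 1 - 1 / treeRoot N α)) with hcdef
  set b := treeRoot N α
  have hbinv : b * b⁻¹ = 1 := mul_inv_cancel₀ (by linarith)
  rcases hk : G.graph.dist y z with _ | k
  · have hyz := G.connected.dist_eq_zero_iff.1 hk
    subst hyz
    rw [hT.laplacian_root y (fun k => c * b⁻¹ ^ k) (by omega), if_pos rfl, hT.m_eq]
    have : α + 1 - 1 / b ≠ 0 := by
      intro h0; rw [hcdef, h0] at hc; simp at hc
    have e : α * (c * b⁻¹ ^ 0) - (c * b⁻¹ ^ 1 - c * b⁻¹ ^ 0) = c * (α + 1 - 1 / b) := by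
      rw [one_div]; ring
    rw [e, hcdef]
    generalize α + 1 - 1 / b = d at *
    field_simp
  · have hyz : y ≠ z := by rintro rfl; simp at hk
    rw [if_neg hyz, ← mul_right_inj' hN0.ne', mul_sub,
      hT.laplacian_of_dist_succ hk fun k => c * b⁻¹ ^ k, mul_zero]
    -- Away from the pole the resolvent equation is the quadratic equation of b times c b^{-(k+2)}.
    have e : ((α + 1) * N * b - b ^ 2 - (N - 1)) * b⁻¹ ^ 2 * (c * b⁻¹ ^ k) = 0 := by
      rw [show (α + 1) * N * b - b ^ 2 - (N - 1) = 0 by linarith]; ring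
    linear_combination e - (c * b⁻¹ ^ k) * ((α + 1) * N * b⁻¹ - (b * b⁻¹ + 1)) * hbinv

/-- Let v be the explicit solution. Cut off to a ball it is a supersolution, which gives the upper
bound. Lowered by a bound ε for its values outside and then cut off, it is a subsolution, which
gives the lower bound up to ε and a semigroup term at time n. Since b ≥ θ, v is dominated by
c·θ^{-|x|}, so that term decays like e^{-μ₁n}; this is what makes α = 0 work. -/
theorem resolventKernel_eq (hN : 3 ≤ N) {α : ℝ} (hα : 0 ≤ α) (x₀ z : V) :
    G.resolventKernel α x₀ z = ENNReal.ofReal (1 / (N * (α + 1 - 1 / treeRoot N α)) *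
      (treeRoot N α)⁻¹ ^ G.graph.dist x₀ z) := by
  classical
  have hN' : (3 : ℝ) ≤ N := by exact_mod_cast hN
  have hρ := hT.isAdmissibleMetric
  have hb1 := one_lt_treeRoot hN hα
  have hbθ := sqrt_le_treeRoot hN hα
  have hc := treeConst_pos hN hα
  have hgreen := hT.green_equation hN hα z
  have hl := sqrt_sub_one_div_lt hN
  have hhl := hT.laplacian_sqrt_pow_le hN z
  have hθ : 0 < Real.sqrt ((N : ℝ) - 1) := Real.sqrt_pos.2 (by linarith)
  set c := 1 / (N * (α + 1 - 1 / treeRoot N α)) with hcdef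
  set b := treeRoot N α
  set θ := Real.sqrt ((N : ℝ) - 1)
  set l := 1 - 2 * θ / N
  set v : V → ℝ := fun y => c * b⁻¹ ^ G.graph.dist y z with hv
  set h : V → ℝ := fun y => θ⁻¹ ^ G.graph.dist y z with hh
  have hb0 : 0 < b⁻¹ := inv_pos.2 (by linarith)
  have hvpos : ∀ y, 0 ≤ v y := fun y => mul_nonneg hc.le (pow_nonneg hb0.le _)
  have hhpos : ∀ y, 0 ≤ h y := fun y => pow_nonneg (inv_pos.2 hθ).le _
  have hvh : ∀ y, v y ≤ c * h y := fun y => mul_le_mul_of_nonneg_left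
    (pow_le_pow_left₀ hb0.le (inv_anti₀ hθ hbθ) _) hc.le
  set Ω := hρ.ball z
  have hlim := G.tendsto_truncatedResolvent (hρ.ball_mono z) (hρ.exists_mem_ball z) α x₀ z
  obtain ⟨n₀, hn₀⟩ := hρ.exists_mem_ball z x₀
  have hmem : ∀ n ≥ n₀, x₀ ∈ Ω n := fun n hn => hρ.ball_mono z hn hn₀
  have hmono : ∀ (n : ℕ) (f : V → ℝ), (∀ y ∉ Ω n, 0 ≤ f y) → ∀ y ∈ Ω n,
      G.laplacian (fun y => if y ∈ Ω n then f y else 0) y ≤ G.laplacian f y := by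
    intro n f hf y hy
    refine G.laplacian_mono (fun y => ?_) (if_pos hy)
    split_ifs with hy'
    · exact le_rfl
    · exact hf y hy'
  apply le_antisymm
  · refine le_of_tendsto hlim (eventually_atTop.2 ⟨n₀, fun n hn => ENNReal.ofReal_le_ofReal ?_⟩)
    have := G.truncatedResolvent_le_of_supersolution (Ω := Ω n) (α := α) (T := n) (z := z)
      (f := fun y => if y ∈ Ω n then v y else 0) (fun y hy => if_neg hy)
      (fun y hy => by rw [if_pos hy]; exact hvpos y) n.cast_nonneg (hmem n hn) fun y hy => by
        rw [if_pos hy, ← hgreen y]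
        have := hmono n v (fun y _ => hvpos y) y hy
        linarith
    rwa [if_pos (hmem n hn)] at this
  · have hlow : ∀ n ≥ n₀, v x₀ - c * b⁻¹ ^ (n + 1) - c * (Real.exp (-(l * n)) * h x₀) ≤
        G.truncatedResolvent (Ω n) α n x₀ z := by
      intro n hn
      set ε := c * b⁻¹ ^ (n + 1) with hε
      have hε0 : 0 ≤ ε := mul_nonneg hc.le (pow_nonneg hb0.le _)
      have hx := hmem n hn
      have hn0 : (0 : ℝ) ≤ n := n.cast_nonneg
      have hout : ∀ y ∉ Ω n, v y ≤ ε := by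
        intro y hy
        rw [hρ.mem_ball, combDist, not_le] at hy
        have hy' : n + 1 < G.graph.dist y z := by exact_mod_cast hy
        exact mul_le_mul_of_nonneg_left (pow_le_pow_of_le_one hb0.le
          (inv_le_one_of_one_le₀ hb1.le) hy'.le) hc.le
      set f : V → ℝ := fun y => if y ∈ Ω n then v y - ε else 0 with hf
      have h1 := G.sub_exp_mul_dirichletSemigroup_le_truncatedResolvent (Ω := Ω n) (f := f)
        (α := α) (T := n) (z := z) (fun y hy => if_neg hy) hn0 hx fun y hy => by
          rw [← hgreen y]
          -- f + ε agrees with v on the ball and equals ε ≥ v outside, so it touches v from above at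
          -- y.
          have h2 : G.laplacian v y ≤ G.laplacian (fun y => f y + ε) y := by
            refine G.laplacian_mono (fun y => ?_) (by simp [hf, hy])
            by_cases hy' : y ∈ Ω n
            · simp [hf, hy']
            · simp only [hf, if_neg hy', zero_add]; exact hout y hy'
          have h3 : G.laplacian (fun y => f y + ε) y = G.laplacian f y := by
            simp [laplacian]
          have h4 : f y = v y - ε := if_pos hy
          rw [h4]
          nlinarith [mul_nonneg hα hε0]
      have h5 := G.exp_mul_dirichletSemigroup_le (Ω := Ω n) (l := l) (T := n)
        (f := fun y => if y ∈ Ω n then h y else 0) (fun y hy => if_neg hy) hn0 hx fun y hy => by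
          rw [if_pos hy]
          exact (hmono n h (fun y _ => hhpos y) y hy).trans (hhl y)
      rw [if_pos hx] at h5
      have h6 : G.dirichletSemigroup (Ω n) n f x₀ ≤
          c * G.dirichletSemigroup (Ω n) n (fun y => if y ∈ Ω n then h y else 0) x₀ := by
        rw [← G.dirichletSemigroup_const_mul]
        refine G.dirichletSemigroup_mono _ hn0 (fun y hy => ?_) x₀
        rw [if_pos hy]
        have : f y = v y - ε := if_pos hy
        linarith [hvh y]
      set F := G.dirichletSemigroup (Ω n) n (fun y => if y ∈ Ω n then h y else 0) x₀
      have hF0 : 0 ≤ F := G.dirichletSemigroup_nonneg hn0 (fun y hy => by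
        rw [if_pos hy]; exact hhpos y) x₀
      have h7 : F ≤ Real.exp (-(l * n)) * h x₀ := by
        rw [Real.exp_neg, ← div_eq_inv_mul, le_div_iff₀ (Real.exp_pos _), mul_comm]
        exact h5
      have h8 : Real.exp (-α * n) ≤ 1 := Real.exp_le_one_iff.2 (by nlinarith)
      have h9 : Real.exp (-α * n) * G.dirichletSemigroup (Ω n) n f x₀ ≤
          c * (Real.exp (-(l * n)) * h x₀) :=
        calc Real.exp (-α * n) * G.dirichletSemigroup (Ω n) n f x₀
            ≤ Real.exp (-α * n) * (c * F) := mul_le_mul_of_nonneg_left h6 (Real.exp_pos _).le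
          _ ≤ c * F := mul_le_of_le_one_left (mul_nonneg hc.le hF0) h8
          _ ≤ _ := mul_le_mul_of_nonneg_left h7 hc.le
      have h10 : f x₀ = v x₀ - ε := if_pos hx
      linarith
    have hlim2 : Tendsto (fun n : ℕ => v x₀ - c * b⁻¹ ^ (n + 1) -
        c * (Real.exp (-(l * n)) * h x₀)) atTop (𝓝 (v x₀ - c * 0 - c * (0 * h x₀))) := by
      refine (tendsto_const_nhds.sub (Tendsto.const_mul c ?_)).sub
        (Tendsto.const_mul c (Tendsto.mul_const _ ?_))
      · exact (tendsto_pow_atTop_nhds_zero_of_lt_one hb0.le (inv_lt_one_of_one_lt₀ hb1)).comp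
          (tendsto_add_atTop_nat 1)
      · exact Real.tendsto_exp_neg_atTop_nhds_zero.comp
          (tendsto_natCast_atTop_atTop.const_mul_atTop hl)
    simp only [mul_zero, zero_mul, sub_zero] at hlim2
    exact le_of_tendsto_of_tendsto (ENNReal.tendsto_ofReal hlim2) hlim
      (eventually_atTop.2 ⟨n₀, fun n hn => ENNReal.ofReal_le_ofReal (hlow n hn)⟩)

/-- The annulus consists of the four spheres of radii n, …, n + 3. The condition n ≥ 1 excludes the
root, whose sphere does not obey the formula N(N−1)^{k−1}. -/
theorem resolventSqSum_annulus_eq (hN : 3 ≤ N) {α : ℝ} (hα : 0 ≤ α) (x₀ : V) (n : ℕ)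
    (hn : 1 ≤ n) :
    (G.resolventSqSum α x₀ (annulus G.combDist x₀ n (n + 3))).toReal =
      ((1 / (N * (α + 1 - 1 / treeRoot N α))) ^ 2 * N * (N / ((N : ℝ) - 1)) *
        ∑ i ∈ Finset.range 4, (((N : ℝ) - 1) / treeRoot N α ^ 2) ^ i) *
      (((N : ℝ) - 1) / treeRoot N α ^ 2) ^ n := by
  have hN' : (3 : ℝ) ≤ N := by exact_mod_cast hN
  have hN1 : (0 : ℝ) < (N : ℝ) - 1 := by linarith
  have hb1 := one_lt_treeRoot hN hα
  have hc := treeConst_pos hN hα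
  set c := 1 / (N * (α + 1 - 1 / treeRoot N α)) with hcdef
  set b := treeRoot N α
  have hA : annulus G.combDist x₀ n (n + 3) = ↑(G.shell x₀ (Finset.Ico n (n + 4))) := by
    ext x
    rw [Finset.mem_coe, mem_shell, Finset.mem_Ico]
    simp only [annulus, combDist, Set.mem_ofPred_eq]
    norm_cast
    omega
  have hterm : ∀ x, G.resolventKernel α x₀ x ^ 2 * ENNReal.ofReal (G.m x) =
      ENNReal.ofReal ((c * b⁻¹ ^ G.graph.dist x x₀) ^ 2 * N) := by
    intro x
    have h0 : 0 ≤ c * b⁻¹ ^ G.graph.dist x x₀ :=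
      mul_nonneg hc.le (pow_nonneg (inv_nonneg.2 (by linarith)) _)
    rw [hT.resolventKernel_eq hN hα, SimpleGraph.dist_comm, hT.m_eq,
      ENNReal.ofReal_mul (sq_nonneg _), ENNReal.ofReal_pow h0]
  rw [resolventSqSum, hA, Finset.tsum_subtype' _ fun x =>
    G.resolventKernel α x₀ x ^ 2 * ENNReal.ofReal (G.m x)]
  simp only [hterm]
  rw [← ENNReal.ofReal_sum_of_nonneg fun x _ => by positivity,
    ENNReal.toReal_ofReal (Finset.sum_nonneg fun x _ => by positivity),
    G.sum_shell x₀ _ fun k => (c * b⁻¹ ^ k) ^ 2 * N, Finset.sum_Ico_eq_sum_range,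
    Nat.add_sub_cancel_left, Finset.mul_sum, Finset.sum_mul]
  refine Finset.sum_congr rfl fun i _ => ?_
  obtain ⟨j, hj⟩ : ∃ j, n + i = j + 1 := ⟨n + i - 1, by omega⟩
  have e : (((N : ℝ) - 1) / b ^ 2) ^ i * (((N : ℝ) - 1) / b ^ 2) ^ n =
      ((N : ℝ) - 1) ^ (j + 1) * (b⁻¹ ^ (j + 1)) ^ 2 := by
    rw [← pow_add, add_comm i n, hj, div_eq_mul_inv, mul_pow, ← inv_pow, ← pow_mul, ← pow_mul,
      mul_comm 2]
  rw [hj, hT.card_sphere_succ, mul_assoc (c ^ 2 * N * (N / ((N : ℝ) - 1))), e]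
  field_simp
  ring

end IsRegularTree

end WeightedGraph

/-! ### The theorem -/

theorem mainTheorem2 :
    -- the decay estimate
    (∀ (V : Type*) [Infinite V] (G : WeightedGraph V) (ρ : V → V → ℝ),
      G.IsAdmissibleMetric ρ → 0 < G.bottomSpectrum Set.univ →
      ∀ (x₀ : V) (α : ℝ), 0 ≤ α →
        ∃ C : ℝ, ∀ R : ℝ, 0 < R →
          G.resolventSqSum α x₀ (WeightedGraph.annulus ρ x₀ R (R + 3 * G.jumpSize ρ)) ≤
            ENNReal.ofReal (C * Real.exp
              (-2 * G.decayExponent ρ (-α) (G.bottomSpectrum Set.univ) * R))) ∧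
    -- sharpness on homogeneous trees
    (∀ (N : ℕ), 3 ≤ N → ∀ (α : ℝ), 0 ≤ α →
      ∃ C : ℝ, 0 < C ∧
        ∀ (V : Type*) (G : WeightedGraph V), G.IsRegularTree N →
          Infinite V ∧
          G.IsAdmissibleMetric G.combDist ∧
          G.jumpSize G.combDist = 1 ∧
          G.bottomSpectrum Set.univ = 1 - 2 * Real.sqrt ((N : ℝ) - 1) / N ∧
          0 < G.bottomSpectrum Set.univ ∧
          (∀ x₀ x : V, G.resolventKernel α x₀ x =
            ENNReal.ofReal (1 / (N * (α + 1 - 1 / treeRoot N α)) *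
              (treeRoot N α)⁻¹ ^ G.graph.dist x x₀)) ∧
          (∀ x₀ : V, Asymptotics.IsEquivalent Filter.atTop
            (fun n : ℕ =>
              (G.resolventSqSum α x₀ (WeightedGraph.annulus G.combDist x₀ n (n + 3))).toReal)
            (fun n : ℕ => C * (((N : ℝ) - 1) / treeRoot N α ^ 2) ^ n)) ∧
          (∀ n : ℕ, (((N : ℝ) - 1) / treeRoot N α ^ 2) ^ n =
            Real.exp (-2 * G.decayExponent G.combDist (-α)
              (G.bottomSpectrum Set.univ) * n))) := by
  refine ⟨?_, ?_⟩
  · intro V _ G ρ hρ h0 x₀ α hα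
    have h : ∃ C : ℝ, ∀ R R' : ℝ, G.resolventSqSum α x₀ (WeightedGraph.annulus ρ x₀ R R') ≤
        ENNReal.ofReal (C * Real.exp
          (-2 * G.decayExponent ρ (-α) (G.bottomSpectrum Set.univ) * R)) := by
      by_cases hd : ρ = G.combDist
      · subst hd
        exact G.exists_decay_of_combDist hρ h0 hα x₀
      · exact G.exists_decay_of_ne_combDist hρ hd (by linarith) x₀
    obtain ⟨C, hC⟩ := h
    exact ⟨C, fun R _ => hC R _⟩
  · intro N hN α hα
    have hN' : (3 : ℝ) ≤ N := by exact_mod_cast hN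
    have hN1 : (0 : ℝ) < (N : ℝ) - 1 := by linarith
    have hb : 0 < treeRoot N α := one_pos.trans (one_lt_treeRoot hN hα)
    have hc := treeConst_pos hN hα
    refine ⟨(1 / (N * (α + 1 - 1 / treeRoot N α))) ^ 2 * N * (N / ((N : ℝ) - 1)) *
        ∑ i ∈ Finset.range 4, (((N : ℝ) - 1) / treeRoot N α ^ 2) ^ i, ?_, ?_⟩
    · have : 0 < ∑ i ∈ Finset.range 4, (((N : ℝ) - 1) / treeRoot N α ^ 2) ^ i :=
        Finset.sum_pos (fun i _ => by positivity) ⟨0, by simp⟩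
      positivity
    · intro V G hT
      have hinf := hT.infinite hN
      have hbs := hT.bottomSpectrum_eq hN
      refine ⟨hinf, hT.isAdmissibleMetric, G.jumpSize_combDist, hbs, ?_, fun x₀ x => ?_,
        fun x₀ => ?_, fun n => ?_⟩
      · rw [hbs]
        exact sqrt_sub_one_div_lt hN
      · rw [hT.resolventKernel_eq hN hα, SimpleGraph.dist_comm]
      -- The asymptotic relation is an exact equality from n = 1 on.
      · refine Filter.EventuallyEq.isEquivalent ?_
        filter_upwards [Filter.eventually_ge_atTop 1] with n hn
        exact hT.resolventSqSum_annulus_eq hN hα x₀ n hn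
      · rw [G.decayExponent_combDist, hbs, sub_sub_cancel, sub_neg_eq_add]
        exact exp_neg_mul_decay hN hα n
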